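/- Let $(\mathcal N_k)_{k\ge 1}$ be i.i.d. complex Gaussian random variables with $\mathbb E[\mathcal N_k]=\mathbb E[\mathcal N_k^2]=0$ and $\mathbb E[|\mathcal N_k|^2]=1$, and for $|z|<1$ let $G^{\mathbb C}(z)=\sum_{k\ge 1}\frac{z^k}{\sqrt k}\mathcal N_k$ (the series converges almost surely on the whole open unit disc). For $n\ge 0$, let $c_n$ be the $n$-th Fourier coefficient of the holomorphic multiplicative chaos of (critical) parameter $\theta=1$, that is, $$c_n=\lim_{r\to 1^-}\frac1{2\pi}\int_0^{2\pi}e^{G^{\mathbb C}(re^{i\vartheta})}\,\overline{(re^{i\vartheta})^n}\,d\vartheta ,$$ where the limit exists almost surely; equivalently, $c_n$ is the coefficient of $z^n$ in the power series expansion of $e^{G^{\mathbb C}(z)}$ at $z=0$. Then, uniformly in $y\ge 2$ and $n\ge 1$, $$\mathbb P\left((\log n)^{1/4}|c_n|\ge y\right)=\mathcal O\left(\frac{\min(\sqrt{\log n},\log y)}{y^2}\right),$$ that is, there is an absolute constant $C$ such that for all real $y\ge 2$ and all integers $n\ge 1$ the left-hand side is at most $C\min(\sqrt{\log n},\log y)/y^2$.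 -/

import Mathlib

open MeasureTheory ProbabilityTheory

/-- `Z` is a standard complex Gaussian variable under `μ`: it is (jointly, as a vector of `ℂ ≃ ℝ²`)
Gaussian, with `E[Z] = E[Z²] = 0` and `E[|Z|²] = 1`. -/
structure IsStdComplexGaussian {Ω : Type*} [MeasurableSpace Ω] (Z : Ω → ℂ) (μ : Measure Ω) :
    Prop where
  gaussian : HasGaussianLaw Z μ
  mean : ∫ ω, Z ω ∂μ = 0
  sq_mean : ∫ ω, Z ω ^ 2 ∂μ = 0
  normSq_mean : ∫ ω, ‖Z ω‖ ^ 2 ∂μ = 1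

/-- The holomorphic function `G(z) = ∑_{k ≥ 1} z^k / √k * a_k` on the open unit disc, for a
coefficient sequence `a` (a realization of the Gaussian variables). When the `a_k` are
realizations of i.i.d. standard complex Gaussians, the series almost surely converges absolutely
at every point of the open unit disc. -/
noncomputable def gaussianSeries (a : ℕ+ → ℂ) (z : ℂ) : ℂ :=
  ∑' k : ℕ+, z ^ (k : ℕ) / (Real.sqrt ((k : ℕ) : ℝ) : ℂ) * a k

/-- The action of the holomorphic multiplicative chaos of parameter `θ` on (the extension to
`ℂ \ {0}` as a Laurent polynomial `φ` of) a trigonometric polynomial: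
`lim_{r → 1⁻} (1 / 2π) ∫_0^{2π} exp(√θ G(r e^{iϑ})) * conj (φ(r e^{iϑ})) dϑ`.
Almost surely, this limit exists for every Laurent polynomial `φ`. -/
noncomputable def hmc (θ : ℝ) (a : ℕ+ → ℂ) (φ : ℂ → ℂ) : ℂ :=
  Filter.limUnder (nhdsWithin (1 : ℝ) (Set.Iio 1)) fun r : ℝ =>
    (1 / (2 * Real.pi) : ℂ) * ∫ t in (0 : ℝ)..(2 * Real.pi),
      Complex.exp ((Real.sqrt θ : ℂ) * gaussianSeries a (r * Complex.exp (Complex.I * t))) *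
        (starRingEnd ℂ) (φ (r * Complex.exp (Complex.I * t)))

/-- The `n`-th Fourier coefficient of the holomorphic multiplicative chaos of parameter `θ`:
its action on `e^{iϑ} ↦ e^{inϑ}`, which extends as `z ↦ z^n`. -/
noncomputable def hmcCoeff (θ : ℝ) (a : ℕ+ → ℂ) (n : ℕ) : ℂ :=
  hmc θ a fun z => z ^ n

/-!
Only the frequencies `k ≤ n` enter `c_n`, so `c_n` is a coefficient of a truncated chaos, whose
coefficients are orthogonal with variance at most `1`. Chebyshev's inequality then gives the bound
by `√(log n) / y²`.

For the bound by `log y / y²`, the second moment of `c_n` is computed on a good event of probability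
`1 - O(y⁻²)`: by Markov's inequality, the Hardy norm of the chaos truncated at frequency `2 ^ j`, on
a circle of radius `1 + O(2⁻ʲ)`, is at most `y (j + 1)` times its typical size, simultaneously for
all `j`. On this event the real part of the field at each point of the circle is at most
`j log 2 + log y + log (j + 1) + O(1)` at every scale `j`. Reweighting by the squared modulus of the
chaos adds to the field, by Cameron–Martin, a drift of at least `log 2` per scale, so the unweighted
field becomes a Gaussian walk constrained to stay below `log y + log (j + 1) + O(1)`. By a ballot
estimate this has probability `O((1 + log y) / √j)` up to the scale `j ≈ log₂ n`, and the factor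
`1 / √j` is what the normalization `(log n)^(1/4)` compensates. Splitting `c_n` along the dyadic
blocks of frequencies, the randomness of the last block transfers this bound on the energy of the
lower frequencies to the individual coefficient.
-/

section ProductMeasure

variable {ι κ γ δ : Type*} {X : ι → Type*} [∀ i, MeasurableSpace (X i)] [MeasurableSpace γ]
  [MeasurableSpace δ] {μ : ∀ i, Measure (X i)} [∀ i, IsProbabilityMeasure (μ i)]

theorem exists_measurable_comp_restrict_of_dependsOn [∀ i, Nonempty (X i)] {s : Finset ι}
    {f : (∀ i, X i) → γ} (hf : Measurable f) (hfs : DependsOn f s) :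
    ∃ g : (∀ i : s, X i) → γ, Measurable g ∧ f = g ∘ s.restrict := by
  classical
  let extend : (∀ i : s, X i) → ∀ i, X i := fun y i =>
    if h : i ∈ s then y ⟨i, h⟩ else Classical.arbitrary (X i)
  have extend_meas : Measurable extend := by
    refine measurable_pi_lambda _ fun i => ?_
    by_cases h : i ∈ s
    · simpa [extend, h] using measurable_pi_apply (⟨i, h⟩ : s)
    · simp [extend, h]
  refine ⟨f ∘ extend, hf.comp extend_meas, funext fun x => hfs fun i hi => ?_⟩
  simp [extend, Finset.mem_coe.1 hi]

theorem indepFun_infinitePi_of_dependsOn {s t : Finset ι} (hst : Disjoint s t)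
    {f : (∀ i, X i) → γ} {g : (∀ i, X i) → δ} (hf : Measurable f) (hg : Measurable g)
    (hfs : DependsOn f s) (hgt : DependsOn g t) :
    IndepFun f g (Measure.infinitePi μ) := by
  have (i : ι) : Nonempty (X i) := nonempty_of_isProbabilityMeasure (μ i)
  obtain ⟨f', hf', rfl⟩ := exists_measurable_comp_restrict_of_dependsOn hf hfs
  obtain ⟨g', hg', rfl⟩ := exists_measurable_comp_restrict_of_dependsOn hg hgt
  have coords_indep : iIndepFun (fun i (x : ∀ i, X i) => x i) (Measure.infinitePi μ) :=
    iIndepFun_infinitePi fun _ => measurable_id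
  exact (coords_indep.indepFun_finset s t hst fun i => measurable_pi_apply i).comp hf' hg'

theorem iIndepFun_infinitePi_of_dependsOn {s : κ → Finset ι}
    (hs : Pairwise fun j k => Disjoint (s j) (s k)) {f : κ → (∀ i, X i) → γ}
    (hf : ∀ j, Measurable (f j)) (hfs : ∀ j, DependsOn (f j) (s j)) :
    iIndepFun f (Measure.infinitePi μ) := by
  classical
  rw [iIndepFun_iff_measure_inter_preimage_eq_mul]
  intro S
  induction S using Finset.induction_on with
  | empty => intro B _; simp
  | insert a S ha ih =>
    intro B hB
    have hdisj : Disjoint (s a) (S.biUnion s) :=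
      (Finset.disjoint_biUnion_right _ _ _).2 fun j hj => hs (ne_of_mem_of_not_mem hj ha).symm
    have hdep : DependsOn (fun x (j : S) => f j x) (S.biUnion s : Set ι) := fun x y h =>
      funext fun j => hfs j fun i hi => h i (Finset.mem_biUnion.2 ⟨j, j.2, hi⟩)
    have hindep := indepFun_infinitePi_of_dependsOn (μ := μ) hdisj (hf a)
      (measurable_pi_lambda _ fun j : S => hf j) (hfs a) hdep
    have hpre : ⋂ j ∈ S, f j ⁻¹' B j =
        (fun x (j : S) => f j x) ⁻¹' Set.univ.pi fun j : S => B j := by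
      ext x
      simp
    rw [Finset.set_biInter_insert, Finset.prod_insert ha,
      ← ih fun j hj => hB j (Finset.mem_insert_of_mem hj), hpre]
    exact hindep.measure_inter_preimage_eq_mul _ _ (hB a (Finset.mem_insert_self a S))
      (MeasurableSet.univ_pi fun j : S => hB j (Finset.mem_insert_of_mem j.2))

theorem setIntegral_infinitePi_of_dependsOn {𝕜 : Type*} [RCLike 𝕜] {s t : Finset ι}
    (hst : Disjoint s t) {E : Set (∀ i, X i)} {f : (∀ i, X i) → 𝕜} (hE : MeasurableSet E)
    (hf : Measurable f) (hEs : DependsOn (· ∈ E) (s : Set ι)) (hft : DependsOn f t) :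
    ∫ x in E, f x ∂Measure.infinitePi μ =
      (Measure.infinitePi μ).real E * ∫ x, f x ∂Measure.infinitePi μ := by
  classical
  have hind : DependsOn (E.indicator (1 : (∀ i, X i) → 𝕜)) s := fun x y hxy => by
    simp only [Set.indicator_apply, hEs hxy, Pi.one_apply]
  have hmeas : Measurable (E.indicator (1 : (∀ i, X i) → 𝕜)) := measurable_one.indicator hE
  have hmul := (indepFun_infinitePi_of_dependsOn (μ := μ) hst hmeas hf hind
    hft).integral_fun_mul_eq_mul_integral hmeas.aestronglyMeasurable hf.aestronglyMeasurable
  have hmass : ∫ x, E.indicator (1 : (∀ i, X i) → 𝕜) x ∂Measure.infinitePi μ =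
      (Measure.infinitePi μ).real E := by
    simp [integral_indicator hE, Algebra.smul_def]
  rw [← hmass, ← hmul, ← integral_indicator hE]
  refine integral_congr_ae (.of_forall fun x => ?_)
  by_cases hx : x ∈ E <;> simp [hx]

theorem measureReal_infinitePi_inter_of_dependsOn {s t : Finset ι} (hst : Disjoint s t)
    {E F : Set (∀ i, X i)} (hE : MeasurableSet E) (hF : MeasurableSet F)
    (hEs : DependsOn (· ∈ E) (s : Set ι)) (hFt : DependsOn (· ∈ F) (t : Set ι)) :
    (Measure.infinitePi μ).real (E ∩ F) =
      (Measure.infinitePi μ).real E * (Measure.infinitePi μ).real F := by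
  have hindep := indepFun_infinitePi_of_dependsOn (μ := μ) hst (measurable_mem.2 hE)
    (measurable_mem.2 hF) hEs hFt
  have h := hindep.measure_inter_preimage_eq_mul {True} {True} trivial trivial
  simp only [Set.preimage, Set.mem_singleton_iff, eq_iff_iff, iff_true, Set.ofPred_mem_eq] at h
  rw [measureReal_def, h, ENNReal.toReal_mul, measureReal_def, measureReal_def]

end ProductMeasure

section GaussianReal

theorem map_sum_infinitePi_gaussianReal {ι : Type*} (v : ι → NNReal) (s : Finset ι) :
    (Measure.infinitePi fun i => gaussianReal 0 (v i)).map (fun x => ∑ i ∈ s, x i) =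
      gaussianReal 0 (∑ i ∈ s, v i) := by
  classical
  induction s using Finset.induction_on with
  | empty => simp [Measure.map_const]
  | insert a s ha ih =>
    have hindep : IndepFun (fun x : ι → ℝ => x a) (fun x => ∑ i ∈ s, x i)
        (Measure.infinitePi fun i => gaussianReal 0 (v i)) :=
      indepFun_infinitePi_of_dependsOn (s := {a}) (Finset.disjoint_singleton_left.2 ha)
        (by fun_prop) (by fun_prop) (fun x y h => h a (by simp))
        fun x y h => Finset.sum_congr rfl fun i hi => h i hi
    have hsum := gaussianReal_add_gaussianReal_of_indepFun hindep
      (Measure.infinitePi_map_eval _ a) ih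
    rw [add_zero] at hsum
    simp only [Finset.sum_insert ha, ← hsum]
    rfl

theorem gaussianReal_zero_real_Ioi_zero_le (v : NNReal) :
    (gaussianReal 0 v).real (Set.Ioi 0) ≤ 1 / 2 := by
  have hsymm : (gaussianReal 0 v).real (Set.Ioi 0) = (gaussianReal 0 v).real (Set.Iio 0) := by
    have h := gaussianReal_map_neg (μ := 0) (v := v)
    rw [neg_zero] at h
    conv_lhs => rw [← h]
    rw [map_measureReal_apply measurable_neg measurableSet_Ioi]
    simp
  have hdisj : Disjoint (Set.Ioi (0 : ℝ)) (Set.Iio 0) := Set.Ioi_disjoint_Iio_same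
  have htotal := measureReal_le_one (μ := gaussianReal 0 v) (s := Set.Ioi 0 ∪ Set.Iio 0)
  rw [measureReal_union hdisj measurableSet_Iio] at htotal
  linarith

theorem gaussianPDFReal_le_one_div_sqrt (m : ℝ) (v : NNReal) (t : ℝ) :
    gaussianPDFReal m v t ≤ 1 / √v := by
  rcases eq_or_ne v 0 with rfl | hv
  · simp
  have hv' : (0 : ℝ) < v := by positivity
  have hexp : Real.exp (-(t - m) ^ 2 / (2 * v)) ≤ 1 :=
    Real.exp_le_one_iff.2 (div_nonpos_of_nonpos_of_nonneg (by nlinarith [sq_nonneg (t - m)])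
      (by positivity))
  have hsqrt : √v ≤ √(2 * Real.pi * v) := Real.sqrt_le_sqrt (by nlinarith [Real.pi_gt_three])
  calc gaussianPDFReal m v t = (√(2 * Real.pi * v))⁻¹ * Real.exp (-(t - m) ^ 2 / (2 * v)) := rfl
    _ ≤ (√v)⁻¹ * 1 := by gcongr
    _ = 1 / √v := by ring

theorem gaussianReal_zero_real_Ici_neg_le {v : NNReal} (hv : v ≠ 0) {x : ℝ} (hx : 0 ≤ x) :
    (gaussianReal 0 v).real (Set.Ici (-x)) ≤ 1 / 2 + x / √v := by
  have hcover : Set.Ici (-x) ⊆ Set.Ioi 0 ∪ Set.Icc (-x) 0 := fun t ht =>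
    (lt_or_ge 0 t).imp id fun h => ⟨ht, h⟩
  have hIcc : (gaussianReal 0 v).real (Set.Icc (-x) 0) ≤ x / √v := by
    rw [measureReal_def, gaussianReal_apply_eq_integral 0 hv,
      ENNReal.toReal_ofReal (integral_nonneg fun t => gaussianPDFReal_nonneg _ _ _)]
    have h := norm_setIntegral_le_of_norm_le_const (μ := volume) (s := Set.Icc (-x) 0)
      (f := gaussianPDFReal 0 v) (by simp) fun t _ =>
        (Real.norm_of_nonneg (gaussianPDFReal_nonneg _ _ _)).trans_le
          (gaussianPDFReal_le_one_div_sqrt 0 v t)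
    refine (Real.le_norm_self _).trans (h.trans_eq ?_)
    simp [hx, div_eq_inv_mul]
  calc (gaussianReal 0 v).real (Set.Ici (-x))
      ≤ (gaussianReal 0 v).real (Set.Ioi 0 ∪ Set.Icc (-x) 0) := measureReal_mono hcover
    _ ≤ _ := measureReal_union_le _ _
    _ ≤ _ := add_le_add (gaussianReal_zero_real_Ioi_zero_le v) hIcc

end GaussianReal

section HalvingRecursion

variable {p D : ℕ → ℝ} {K L : ℝ} {T : ℕ}

theorem le_div_sqrt_of_halving {E : ℝ} (hE : 1 ≤ E) (hp : p 0 ≤ 1)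
    (hhalf : ∀ t ≤ T, 0 < t → p t ≤ 20 * E / √t + 13 / 20 * p (t / 2)) :
    p T ≤ 400 * E / √(T + 1) := by
  induction T using Nat.strong_induction_on with
  | _ T ih =>
  rcases T.eq_zero_or_pos with rfl | hT
  · simp only [CharP.cast_eq_zero, zero_add, Real.sqrt_one, div_one]
    linarith
  have hle : T / 2 ≤ T := Nat.div_le_self T 2
  have ih_half : p (T / 2) ≤ 400 * E / √((T / 2 : ℕ) + 1) :=
    ih (T / 2) (Nat.div_lt_self hT one_lt_two) fun t ht => hhalf t (ht.trans hle)
  have sqrt_succ_le : ∀ x : ℝ, (T : ℝ) + 1 ≤ 2 * x → √((T : ℝ) + 1) ≤ 1415 / 1000 * √x := by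
    intro x hx
    calc √((T : ℝ) + 1) ≤ √(2 * x) := Real.sqrt_le_sqrt hx
      _ = √2 * √x := Real.sqrt_mul zero_le_two x
      _ ≤ _ := by gcongr; rw [Real.sqrt_le_left (by norm_num)]; norm_num
  have hT_le := sqrt_succ_le T (by norm_cast; lia)
  have hhalf_le := sqrt_succ_le ((T / 2 : ℕ) + 1) (by norm_cast; lia)
  have bound_T : 20 * E / √T ≤ 283 / 10 * E / √((T : ℝ) + 1) := by
    rw [div_le_div_iff₀ (by positivity) (by positivity)]
    linear_combination (20 * E) * hT_le
  have bound_half : 400 * E / √((T / 2 : ℕ) + 1) ≤ 566 * E / √((T : ℝ) + 1) := by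
    rw [div_le_div_iff₀ (by positivity) (by positivity)]
    linear_combination (400 * E) * hhalf_le
  calc p T ≤ 283 / 10 * E / √((T : ℝ) + 1) + 13 / 20 * (566 * E / √((T : ℝ) + 1)) := by
        linarith [hhalf T le_rfl hT]
    _ = 3962 / 10 * E / √((T : ℝ) + 1) := by ring
    _ ≤ _ := by gcongr; norm_num

theorem one_le_natCast_add_one_rpow (n : ℕ) {a : ℝ} (ha : 0 ≤ a) : 1 ≤ ((n : ℝ) + 1) ^ a :=
  Real.one_le_rpow (by norm_cast; lia) ha

theorem sum_div_succ_le_rpow (hp : ∀ t, p t ≤ 1) (t : ℕ) :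
    ∑ j ∈ Finset.range t, p j / ((j : ℝ) + 1) ≤ 5 * ((t : ℝ) + 1) ^ (1 / 4 : ℝ) :=
  calc ∑ j ∈ Finset.range t, p j / ((j : ℝ) + 1)
      ≤ ∑ j ∈ Finset.range t, ((j : ℝ) + 1)⁻¹ := by
        simp_rw [← one_div]
        gcongr
        exact hp _
    _ = (harmonic t : ℚ) := by simp [harmonic]
    _ ≤ 1 + Real.log t := harmonic_le_one_add_log t
    _ ≤ 1 + Real.log (t + 1) := by
        rcases t.eq_zero_or_pos with rfl | h
        · simp
        · gcongr
          linarith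
    _ ≤ 1 + ((t : ℝ) + 1) ^ (1 / 4 : ℝ) / (1 / 4) := by
        gcongr
        exact Real.log_le_rpow_div (by positivity) (by norm_num)
    _ ≤ _ := by linarith [one_le_natCast_add_one_rpow t (a := 1 / 4) (by norm_num)]

theorem le_rpow_of_le_add_sum (hK : 1 ≤ K) (hL : 0 ≤ L) (hp : ∀ t, p t ≤ 1)
    (hD : ∀ t ≤ T, D t ≤ L + K * ∑ j ∈ Finset.range t, p j / ((j : ℝ) + 1)) {t : ℕ} (ht : t ≤ T) :
    D t ≤ 6 * K * (1 + L) * ((t : ℝ) + 1) ^ (1 / 4 : ℝ) := by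
  have hr := one_le_natCast_add_one_rpow t (a := 1 / 4) (by norm_num)
  set r := ((t : ℝ) + 1) ^ (1 / 4 : ℝ)
  have hKr : 1 ≤ K * r := one_le_mul_of_one_le_of_one_le hK hr
  calc D t ≤ L + K * (5 * r) := (hD t ht).trans (by gcongr; exact sum_div_succ_le_rpow hp t)
    _ ≤ 6 * K * (1 + L) * r := by nlinarith [mul_le_mul_of_nonneg_left hKr hL]

theorem div_succ_le_rpow_of_halving (hK : 1 ≤ K) (hL : 0 ≤ L) (hp : ∀ t, p t ≤ 1)
    (hD : ∀ t ≤ T, D t ≤ L + K * ∑ j ∈ Finset.range t, p j / ((j : ℝ) + 1))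
    (hhalf : ∀ t ≤ T, 0 < t → p t ≤ 20 * D t / √t + 13 / 20 * p (t / 2)) {t : ℕ} (ht : t ≤ T) :
    p t / ((t : ℝ) + 1) ≤ 2400 * K * (1 + L) * ((t : ℝ) + 1) ^ (-(5 / 4) : ℝ) := by
  have ht0 : (0 : ℝ) < (t : ℝ) + 1 := by positivity
  have hE : 1 ≤ 6 * K * (1 + L) * ((t : ℝ) + 1) ^ (1 / 4 : ℝ) :=
    one_le_mul_of_one_le_of_one_le (one_le_mul_of_one_le_of_one_le (by linarith) (by linarith))
      (one_le_natCast_add_one_rpow t (by norm_num))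
  have hpt := le_div_sqrt_of_halving hE (hp 0) (T := t) fun u hu hu0 =>
    (hhalf u (hu.trans ht) hu0).trans (by
      gcongr
      exact (le_rpow_of_le_add_sum hK hL hp hD (hu.trans ht)).trans (by gcongr))
  calc p t / ((t : ℝ) + 1)
      ≤ 400 * (6 * K * (1 + L) * ((t : ℝ) + 1) ^ (1 / 4 : ℝ)) / √((t : ℝ) + 1) / (t + 1) := by
        gcongr
    _ = 2400 * K * (1 + L) * (((t : ℝ) + 1) ^ (1 / 4 : ℝ) / √((t : ℝ) + 1) / (t + 1)) := by ring
    _ = _ := by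
        rw [Real.sqrt_eq_rpow, ← Real.rpow_sub ht0, ← Real.rpow_sub_one ht0.ne']
        norm_num

/- The logarithmic growth of the harmonic sum makes `D` nearly bounded; feeding the resulting decay
of `p` back into the bound for `D` makes the sum converge, so that `D` is bounded after all. -/
theorem exists_le_div_sqrt_of_halving (hK : 1 ≤ K) : ∃ C : ℝ, 0 < C ∧ ∀ {p D : ℕ → ℝ} {L : ℝ}
    {T : ℕ}, 0 ≤ L → (∀ t, p t ≤ 1) →
    (∀ t ≤ T, D t ≤ L + K * ∑ j ∈ Finset.range t, p j / ((j : ℝ) + 1)) →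
    (∀ t ≤ T, 0 < t → p t ≤ 20 * D t / √t + 13 / 20 * p (t / 2)) →
    p T ≤ C * (1 + L) / √(T + 1) := by
  have hsummable : Summable fun j : ℕ => ((j : ℝ) + 1) ^ (-(5 / 4) : ℝ) := by
    have h := (Real.summable_nat_rpow (p := -(5 / 4))).2 (by norm_num)
    simpa using (summable_nat_add_iff 1).2 h
  set W : ℝ := ∑' j : ℕ, ((j : ℝ) + 1) ^ (-(5 / 4) : ℝ)
  have : 0 ≤ W := tsum_nonneg fun j => by positivity
  refine ⟨400 * (1 + K * (2400 * K * W)), by positivity, fun {p D L T} hL hp hD hhalf => ?_⟩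
  have hDt : ∀ t ≤ T, D t ≤ (1 + K * (2400 * K * W)) * (1 + L) := fun t ht =>
    calc D t ≤ L + K * ∑ j ∈ Finset.range t, p j / ((j : ℝ) + 1) := hD t ht
      _ ≤ L + K * ∑ j ∈ Finset.range t, 2400 * K * (1 + L) * ((j : ℝ) + 1) ^ (-(5 / 4) : ℝ) := by
          gcongr with j hj
          exact div_succ_le_rpow_of_halving hK hL hp hD hhalf
            ((Finset.mem_range.1 hj).le.trans ht)
      _ ≤ L + K * (2400 * K * (1 + L) * W) := by
          rw [← Finset.mul_sum]
          gcongr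
          exact hsummable.sum_le_tsum _ fun j _ => by positivity
      _ ≤ _ := by linarith
  have hE : 1 ≤ (1 + K * (2400 * K * W)) * (1 + L) :=
    one_le_mul_of_one_le_of_one_le (le_add_of_nonneg_right (by positivity)) (by linarith)
  refine (le_div_sqrt_of_halving hE (hp 0) fun t ht ht0 => (hhalf t ht ht0).trans ?_).trans_eq
    (by ring)
  gcongr
  exact hDt t ht

end HalvingRecursion

section Ballot

/-- The walks with increments `x` that stay below the barrier `L + log (j + 1)` up to time `T`. -/
def belowBarrier (L : ℝ) (T : ℕ) : Set (ℕ → ℝ) :=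
  {x | ∀ j ≤ T, ∑ l ∈ Finset.range j, x l ≤ L + Real.log (j + 1)}

theorem measurableSet_belowBarrier (L : ℝ) (T : ℕ) : MeasurableSet (belowBarrier L T) := by
  simp only [belowBarrier, Set.ofPred_forall]
  exact .iInter fun j => .iInter fun _ => measurableSet_le (by fun_prop) measurable_const

theorem dependsOn_mem_belowBarrier (L : ℝ) (T : ℕ) :
    DependsOn (· ∈ belowBarrier L T) (Finset.range T : Set ℕ) := by
  intro x y hxy
  refine propext (forall₂_congr fun j hj => ?_)
  rw [Finset.sum_congr rfl fun l hl => hxy l ?_]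
  exact Finset.mem_coe.2 (Finset.range_mono hj hl)

theorem belowBarrier_anti (L : ℝ) {S T : ℕ} (h : S ≤ T) :
    belowBarrier L T ⊆ belowBarrier L S := fun _ hx j hj => hx j (hj.trans h)

/-- The distance, at time `T`, of the walk with increments `x` to the raised barrier
`L + 2 log (T + 1)`. Raising the barrier keeps the distance above `log (T + 1)` on
`belowBarrier L T`. -/
noncomputable def barrierGap (L : ℝ) (T : ℕ) (x : ℕ → ℝ) : ℝ :=
  L + 2 * Real.log (T + 1) - ∑ l ∈ Finset.range T, x l

theorem log_le_barrierGap {L : ℝ} {T : ℕ} {x : ℕ → ℝ} (hx : x ∈ belowBarrier L T) :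
    Real.log (T + 1) ≤ barrierGap L T x := by
  have hT := hx T le_rfl
  unfold barrierGap
  linarith

theorem barrierGap_nonneg {L : ℝ} {T : ℕ} {x : ℕ → ℝ} (hx : x ∈ belowBarrier L T) :
    0 ≤ barrierGap L T x :=
  (Real.log_nonneg (by norm_cast; lia)).trans (log_le_barrierGap hx)

theorem log_succ_sub_log_le (T : ℕ) :
    Real.log (T + 2) - Real.log (T + 1) ≤ 1 / ((T : ℝ) + 1) := by
  rw [← Real.log_div (by positivity) (by positivity)]
  refine (Real.log_le_sub_one_of_pos (by positivity)).trans_eq ?_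
  field_simp
  ring

theorem sub_log_le_exp_two_mul_div_sq (x : ℝ) {a : ℝ} (ha : 0 < a) :
    x - Real.log a ≤ Real.exp (2 * x) / a ^ 2 := by
  have hexp : Real.exp (2 * x) / a ^ 2 = Real.exp (2 * (x - Real.log a)) := by
    rw [mul_sub, Real.exp_sub, two_mul (Real.log a), Real.exp_add, Real.exp_log ha, sq]
  rw [hexp]
  linarith [Real.add_one_le_exp (2 * (x - Real.log a)), Real.exp_pos (2 * (x - Real.log a)),
    Real.add_one_le_exp (x - Real.log a), Real.exp_pos (x - Real.log a)]

/- The exponential correction absorbs the overshoot of the walks killed at time `T + 1`. -/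
theorem indicator_barrierGap_succ_le (L : ℝ) (T : ℕ) (x : ℕ → ℝ) :
    (belowBarrier L (T + 1)).indicator (barrierGap L (T + 1)) x ≤
      (belowBarrier L T).indicator (fun x => barrierGap L T x +
        (2 / (T + 1) - x T + Real.exp (2 * x T) / (T + 2) ^ 2)) x := by
  by_cases hT : x ∈ belowBarrier L T
  · rw [Set.indicator_of_mem hT]
    have hexp : 0 ≤ Real.exp (2 * x T) / ((T : ℝ) + 2) ^ 2 := by positivity
    have hlog := log_succ_sub_log_le T
    have htwo : 2 / ((T : ℝ) + 1) = 2 * (1 / ((T : ℝ) + 1)) := by ring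
    by_cases hT1 : x ∈ belowBarrier L (T + 1)
    · have hcast : ((T + 1 : ℕ) : ℝ) + 1 = T + 2 := by push_cast; ring
      rw [Set.indicator_of_mem hT1, barrierGap, barrierGap, Finset.sum_range_succ, hcast]
      linarith
    · rw [Set.indicator_of_notMem hT1]
      have hgap := log_le_barrierGap hT
      have hover := sub_log_le_exp_two_mul_div_sq (x T) (a := T + 2) (by positivity)
      have hpos : 0 < 1 / ((T : ℝ) + 1) := by positivity
      linarith
  · rw [Set.indicator_of_notMem hT,
      Set.indicator_of_notMem fun h => hT (belowBarrier_anti L T.le_succ h)]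

variable {v : ℕ → NNReal}

theorem integrable_eval_infinitePi_gaussianReal (i : ℕ) :
    Integrable (fun x : ℕ → ℝ => x i) (Measure.infinitePi fun i => gaussianReal 0 (v i)) :=
  (measurePreserving_eval_infinitePi (fun i => gaussianReal 0 (v i))
    i).integrable_comp_of_integrable ((memLp_id_gaussianReal 1).integrable le_rfl)

theorem integrable_exp_eval_infinitePi_gaussianReal (t : ℝ) (i : ℕ) :
    Integrable (fun x : ℕ → ℝ => Real.exp (t * x i))
      (Measure.infinitePi fun i => gaussianReal 0 (v i)) :=
  (measurePreserving_eval_infinitePi (fun i => gaussianReal 0 (v i))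
    i).integrable_comp_of_integrable (integrable_exp_mul_gaussianReal t)

theorem integral_eval_infinitePi_gaussianReal (i : ℕ) :
    ∫ x, x i ∂(Measure.infinitePi fun i => gaussianReal 0 (v i)) = 0 := by
  have hmap := integral_map (μ := Measure.infinitePi fun i => gaussianReal 0 (v i))
    (measurable_pi_apply i).aemeasurable (f := id) (by fun_prop)
  rw [Measure.infinitePi_map_eval] at hmap
  exact hmap.symm.trans integral_id_gaussianReal

theorem integral_exp_eval_infinitePi_gaussianReal (t : ℝ) (i : ℕ) :
    ∫ x, Real.exp (t * x i) ∂(Measure.infinitePi fun i => gaussianReal 0 (v i)) =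
      Real.exp (v i * t ^ 2 / 2) := by
  have hmgf := mgf_gaussianReal (X := fun x : ℕ → ℝ => x i)
    (measurePreserving_eval_infinitePi (fun i => gaussianReal 0 (v i)) i).map_eq t
  simpa [mgf] using hmgf

theorem integrable_barrierGap (L : ℝ) (T : ℕ) :
    Integrable (barrierGap L T) (Measure.infinitePi fun i => gaussianReal 0 (v i)) :=
  (integrable_const _).sub
    (integrable_finsetSum _ fun i _ => integrable_eval_infinitePi_gaussianReal i)

theorem measurable_barrierGap (L : ℝ) (T : ℕ) : Measurable (barrierGap L T) := by
  unfold barrierGap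
  fun_prop

variable (v) in
/-- The probability that the centred Gaussian walk whose increments have variances `v` stays below
the barrier up to time `T`. -/
noncomputable def barrierProb (L : ℝ) (T : ℕ) : ℝ :=
  (Measure.infinitePi fun i => gaussianReal 0 (v i)).real (belowBarrier L T)

variable (v) in
/-- The mean distance to the raised barrier on the event that the centred Gaussian walk whose
increments have variances `v` stays below the barrier up to time `T`. -/
noncomputable def meanBarrierGap (L : ℝ) (T : ℕ) : ℝ :=
  ∫ x in belowBarrier L T, barrierGap L T x ∂Measure.infinitePi fun i => gaussianReal 0 (v i)

theorem setIntegral_belowBarrier_correction (L δ a : ℝ) (T : ℕ) :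
    ∫ x in belowBarrier L T, (δ - x T + Real.exp (2 * x T) / a)
        ∂Measure.infinitePi (fun i => gaussianReal 0 (v i)) =
      barrierProb v L T * (δ + Real.exp (2 * v T) / a) := by
  have hinteg := integrable_eval_infinitePi_gaussianReal (v := v) T
  have hexp := integrable_exp_eval_infinitePi_gaussianReal (v := v) 2 T
  have hdep : DependsOn (fun x : ℕ → ℝ => δ - x T + Real.exp (2 * x T) / a)
      (({T} : Finset ℕ) : Set ℕ) := fun x y hxy => by simp only [hxy T (by simp)]
  have hvar : (v T : ℝ) * 2 ^ 2 / 2 = 2 * v T := by ring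
  have h := setIntegral_infinitePi_of_dependsOn (μ := fun i => gaussianReal 0 (v i))
    (s := Finset.range T) (by simp) (measurableSet_belowBarrier L T) (by fun_prop)
    (dependsOn_mem_belowBarrier L T) hdep
  rw [integral_add (by exact (integrable_const δ).sub hinteg) (hexp.div_const a),
    integral_sub (integrable_const δ) hinteg, integral_div,
    integral_eval_infinitePi_gaussianReal, integral_exp_eval_infinitePi_gaussianReal, hvar] at h
  simpa [barrierProb] using h

theorem meanBarrierGap_succ_le {b : ℝ} (L : ℝ) (T : ℕ) (hb : v T ≤ b) :
    meanBarrierGap v L (T + 1) ≤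
      meanBarrierGap v L T + (2 + Real.exp (2 * b)) * (barrierProb v L T / (T + 1)) := by
  have hcorr : Integrable (fun x : ℕ → ℝ => 2 / ((T : ℝ) + 1) - x T +
      Real.exp (2 * x T) / (T + 2) ^ 2) (Measure.infinitePi fun i => gaussianReal 0 (v i)) :=
    ((integrable_const _).sub (integrable_eval_infinitePi_gaussianReal T)).add
      ((integrable_exp_eval_infinitePi_gaussianReal 2 T).div_const _)
  have hexp : Real.exp (2 * v T) / ((T : ℝ) + 2) ^ 2 ≤ Real.exp (2 * b) / (T + 1) := by
    gcongr
    nlinarith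
  calc meanBarrierGap v L (T + 1)
      ≤ ∫ x in belowBarrier L T, (barrierGap L T x +
          (2 / (T + 1) - x T + Real.exp (2 * x T) / (T + 2) ^ 2))
          ∂Measure.infinitePi fun i => gaussianReal 0 (v i) := by
        rw [meanBarrierGap, ← integral_indicator (measurableSet_belowBarrier L _),
          ← integral_indicator (measurableSet_belowBarrier L _)]
        exact integral_mono
          ((integrable_barrierGap L _).indicator (measurableSet_belowBarrier L _))
          (((integrable_barrierGap L T).add hcorr).indicator (measurableSet_belowBarrier L _))
          (indicator_barrierGap_succ_le L T)
    _ = meanBarrierGap v L T +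
          barrierProb v L T * (2 / (T + 1) + Real.exp (2 * v T) / (T + 2) ^ 2) := by
        rw [integral_add (integrable_barrierGap L T).integrableOn hcorr.integrableOn,
          setIntegral_belowBarrier_correction, meanBarrierGap]
    _ ≤ meanBarrierGap v L T +
          barrierProb v L T * (2 / (T + 1) + Real.exp (2 * b) / (T + 1)) := by
        have : 0 ≤ barrierProb v L T := measureReal_nonneg
        gcongr
    _ = _ := by ring

theorem meanBarrierGap_le_add_sum {b L : ℝ} (hL : 0 ≤ L) {T : ℕ} (hb : ∀ i < T, v i ≤ b) :
    meanBarrierGap v L T ≤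
      L + (2 + Real.exp (2 * b)) * ∑ j ∈ Finset.range T, barrierProb v L j / (j + 1) := by
  induction T with
  | zero =>
    simpa [meanBarrierGap, barrierGap] using mul_le_of_le_one_left hL measureReal_le_one
  | succ T ih =>
    rw [Finset.sum_range_succ, mul_add, ← add_assoc]
    exact (meanBarrierGap_succ_le L T (hb T T.lt_succ_self)).trans
      (add_le_add_left (ih fun i hi => hb i (hi.trans T.lt_succ_self)) _)

theorem measureReal_belowBarrier_inter_gap_ge_le (L : ℝ) (T : ℕ) {ε : ℝ} (hε : 0 < ε) :
    (Measure.infinitePi fun i => gaussianReal 0 (v i)).real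
        (belowBarrier L T ∩ {x | ε ≤ barrierGap L T x}) ≤ meanBarrierGap v L T / ε := by
  have hmarkov := mul_meas_ge_le_integral_of_nonneg
    ((ae_restrict_iff' (measurableSet_belowBarrier L T)).2
      (.of_forall fun _ hx => barrierGap_nonneg hx))
    (integrable_barrierGap (v := v) L T).integrableOn ε
  rwa [measureReal_restrict_apply (measurableSet_le measurable_const (measurable_barrierGap L T)),
    Set.inter_comm, ← le_div_iff₀' hε] at hmarkov

theorem measureReal_sum_Ico_ge_le {T : ℕ} (hT : 0 < T) (hv : ∀ i < T, (1 / 4 : ℝ) ≤ v i) :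
    (Measure.infinitePi fun i => gaussianReal 0 (v i)).real
        {x | -(√T / 20) ≤ ∑ l ∈ Finset.Ico (T / 2) T, x l} ≤ 13 / 20 := by
  set V : NNReal := ∑ l ∈ Finset.Ico (T / 2) T, v l with hV
  have hV_ge : (T : ℝ) / 8 ≤ V := by
    have hcard : (T : ℝ) ≤ 2 * ((T - T / 2 : ℕ) : ℝ) := by norm_cast; lia
    have hsum := Finset.card_nsmul_le_sum (Finset.Ico (T / 2) T) (fun l => (v l : ℝ)) (1 / 4)
      fun l hl => hv l (Finset.mem_Ico.1 hl).2
    rw [Nat.card_Ico, nsmul_eq_mul] at hsum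
    rw [hV]
    push_cast
    linarith
  have hV_pos : (0 : ℝ) < V := lt_of_lt_of_le (by positivity) hV_ge
  have hsqrt : √T / 20 / √V ≤ 3 / 20 := by
    have hle : √T ≤ 3 * √V := by
      rw [← Real.sqrt_sq (by norm_num : (0 : ℝ) ≤ 3), ← Real.sqrt_mul (by norm_num)]
      exact Real.sqrt_le_sqrt (by linarith)
    rw [div_le_iff₀ (Real.sqrt_pos.2 hV_pos)]
    linarith
  have hlaw := map_measureReal_apply (μ := Measure.infinitePi fun i => gaussianReal 0 (v i))
    (f := fun x => ∑ l ∈ Finset.Ico (T / 2) T, x l) (by fun_prop)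
    (measurableSet_Ici (a := -(√T / 20)))
  rw [map_sum_infinitePi_gaussianReal] at hlaw
  refine hlaw.symm.trans_le ((gaussianReal_zero_real_Ici_neg_le ?_ (by positivity)).trans
    (by linarith))
  exact_mod_cast hV_pos.ne'

theorem belowBarrier_subset_union (L ε : ℝ) (T : ℕ) :
    belowBarrier L T ⊆ (belowBarrier L T ∩ {x | ε ≤ barrierGap L T x}) ∪
      (belowBarrier L (T / 2) ∩ {x | -ε ≤ ∑ l ∈ Finset.Ico (T / 2) T, x l}) := by
  intro x hx
  rcases le_or_gt ε (barrierGap L T x) with hfar | hnear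
  · exact Or.inl ⟨hx, hfar⟩
  have hle : T / 2 ≤ T := Nat.div_le_self T 2
  refine Or.inr ⟨belowBarrier_anti L hle hx, ?_⟩
  have hhalf : ∑ l ∈ Finset.range (T / 2), x l ≤ L + Real.log ((T / 2 : ℕ) + 1) := hx _ hle
  have hlog : Real.log ((T / 2 : ℕ) + 1) ≤ Real.log (T + 1) := by gcongr
  have hlog0 : 0 ≤ Real.log ((T : ℝ) + 1) := Real.log_nonneg (by norm_cast; lia)
  rw [barrierGap, ← Finset.sum_range_add_sum_Ico _ hle] at hnear
  simp only [Set.mem_ofPred_eq]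
  linarith

theorem barrierProb_le_halving (L : ℝ) {T : ℕ} (hT : 0 < T) (hv : ∀ i < T, (1 / 4 : ℝ) ≤ v i) :
    barrierProb v L T ≤ 20 * meanBarrierGap v L T / √T + 13 / 20 * barrierProb v L (T / 2) := by
  set γ := Measure.infinitePi fun i => gaussianReal 0 (v i)
  set F : Set (ℕ → ℝ) := {x | -(√T / 20) ≤ ∑ l ∈ Finset.Ico (T / 2) T, x l}
  have hfar : γ.real (belowBarrier L T ∩ {x | √T / 20 ≤ barrierGap L T x}) ≤
      20 * meanBarrierGap v L T / √T :=
    (measureReal_belowBarrier_inter_gap_ge_le L T (by positivity)).trans_eq (by field_simp)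
  have hF : DependsOn (· ∈ F) (Finset.Ico (T / 2) T : Set ℕ) := fun x y hxy => by
    simp only [F, Set.mem_ofPred_eq,
      Finset.sum_congr rfl fun l hl => hxy l (Finset.mem_coe.2 hl)]
  have hnear : γ.real (belowBarrier L (T / 2) ∩ F) ≤ 13 / 20 * barrierProb v L (T / 2) := by
    rw [measureReal_infinitePi_inter_of_dependsOn
      (Finset.disjoint_left.2 fun a ha hb => by
        simp only [Finset.mem_range, Finset.mem_Ico] at ha hb
        lia)
      (measurableSet_belowBarrier L _) (measurableSet_le measurable_const (by fun_prop))
      (dependsOn_mem_belowBarrier L _) hF, mul_comm]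
    exact mul_le_mul_of_nonneg_right (measureReal_sum_Ico_ge_le hT hv) measureReal_nonneg
  calc barrierProb v L T ≤ _ := measureReal_mono (belowBarrier_subset_union L (√T / 20) T)
    _ ≤ _ := measureReal_union_le _ _
    _ ≤ _ := add_le_add hfar hnear

theorem exists_barrierProb_le (b : ℝ) : ∃ C : ℝ, 0 < C ∧ ∀ {v : ℕ → NNReal} {L : ℝ} {T : ℕ},
    0 ≤ L → (∀ i < T, (1 / 4 : ℝ) ≤ v i) → (∀ i < T, v i ≤ b) →
    barrierProb v L T ≤ C * (1 + L) / √(T + 1) := by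
  obtain ⟨C, hC, hbound⟩ := exists_le_div_sqrt_of_halving (K := 2 + Real.exp (2 * b))
    (by linarith [Real.exp_pos (2 * b)])
  refine ⟨C, hC, fun hL hv hb => hbound hL (fun _ => measureReal_le_one)
    (fun t ht => meanBarrierGap_le_add_sum hL fun i hi => hb i (hi.trans_le ht))
    fun t ht ht0 => barrierProb_le_halving _ ht0 fun i hi => hv i (hi.trans_le ht)⟩

end Ballot

section CameronMartin

theorem infinitePi_withDensity_prod {ι : Type*} {X : ι → Type*} [∀ i, MeasurableSpace (X i)]
    {μ : ∀ i, Measure (X i)} [∀ i, IsProbabilityMeasure (μ i)] {f : ∀ i, X i → ENNReal}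
    (hf : ∀ i, Measurable (f i)) [∀ i, IsProbabilityMeasure ((μ i).withDensity (f i))]
    {s : Finset ι} (hs : ∀ i ∉ s, f i = 1) :
    (Measure.infinitePi μ).withDensity (fun x => ∏ i ∈ s, f i (x i)) =
      Measure.infinitePi fun i => (μ i).withDensity (f i) := by
  classical
  refine Measure.eq_infinitePi _ fun S t ht => ?_
  let t' : ∀ i, Set (X i) := fun i => if i ∈ S then t i else Set.univ
  have ht' (i : ι) : MeasurableSet (t' i) := by
    by_cases hi : i ∈ S <;> simp [t', hi, ht i]
  have hindicator (x : ∀ i, X i) :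
      ((S : Set ι).pi t).indicator (fun x => ∏ i ∈ s, f i (x i)) x =
        ∏ i ∈ S ∪ s, (t' i).indicator (f i) (x i) := by
    by_cases hx : x ∈ (S : Set ι).pi t
    · have hmem (i : ι) : x i ∈ t' i := by
        by_cases hi : i ∈ S <;> simp [t', hi, hx i]
      simp only [Set.indicator_of_mem hx, Set.indicator_of_mem (hmem _)]
      exact Finset.prod_subset Finset.subset_union_right fun i _ hi => by simp [hs i hi]
    · obtain ⟨i, hi, hxi⟩ : ∃ i ∈ S, x i ∉ t i := by simpa [Set.mem_pi] using hx
      rw [Set.indicator_of_notMem hx, Finset.prod_eq_zero (Finset.mem_union_left s hi)]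
      simp [t', hi, hxi]
  have hcoord (i : ι) : ∫⁻ x, (t' i).indicator (f i) (x i) ∂Measure.infinitePi μ =
      (μ i).withDensity (f i) (t' i) := by
    rw [withDensity_apply _ (ht' i), ← lintegral_indicator (ht' i),
      ← Measure.infinitePi_map_eval μ i,
      lintegral_map ((hf i).indicator (ht' i)) (measurable_pi_apply i)]
  have hprod := lintegral_prod_eq_prod_lintegral_of_indepFun (S ∪ s)
    (fun i (x : ∀ i, X i) => (t' i).indicator (f i) (x i))
    (iIndepFun_infinitePi (P := μ) fun i => (hf i).indicator (ht' i))
    fun i => ((hf i).indicator (ht' i)).comp (measurable_pi_apply i)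
  have hbox : MeasurableSet ((S : Set ι).pi t) :=
    .pi S.countable_toSet fun i _ => ht i
  rw [withDensity_apply _ hbox, ← lintegral_indicator hbox, lintegral_congr hindicator, hprod,
    Finset.prod_congr rfl fun i _ => hcoord i]
  refine (Finset.prod_subset Finset.subset_union_left fun i _ hi => ?_).symm.trans
    (Finset.prod_congr rfl fun i hi => by simp [t', hi])
  simp [t', hi]

theorem gaussianReal_withDensity_exp (m t : ℝ) (v : NNReal) :
    (gaussianReal m v).withDensity
        (fun x => ENNReal.ofReal (Real.exp (t * (x - m) - v * t ^ 2 / 2))) =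
      gaussianReal (m + t * v) v := by
  rcases eq_or_ne v 0 with rfl | hv
  · simp [dirac_withDensity]
  have hv' : (v : ℝ) ≠ 0 := by exact_mod_cast hv
  rw [gaussianReal_of_var_ne_zero _ hv, gaussianReal_of_var_ne_zero _ hv,
    ← withDensity_mul _ (measurable_gaussianPDF m v) (by fun_prop)]
  congr 1
  ext x
  rw [Pi.mul_apply, gaussianPDF, gaussianPDF, ← ENNReal.ofReal_mul (gaussianPDFReal_nonneg _ _ _),
    gaussianPDFReal, gaussianPDFReal, mul_assoc, ← Real.exp_add]
  congr 3
  field_simp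
  ring

theorem infinitePi_gaussianReal_withDensity_exp {ι : Type*} [DecidableEq ι] (v : ι → NNReal)
    (t : ℝ) (s : Finset ι) :
    (Measure.infinitePi fun i => gaussianReal 0 (v i)).withDensity
        (fun x => ∏ i ∈ s, ENNReal.ofReal (Real.exp (t * x i - v i * t ^ 2 / 2))) =
      (Measure.infinitePi fun i => gaussianReal 0 (v i)).map
        fun x i => x i + if i ∈ s then t * v i else 0 := by
  set f : ι → ℝ → ENNReal := fun i =>
    if i ∈ s then fun x => ENNReal.ofReal (Real.exp (t * x - v i * t ^ 2 / 2)) else 1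
  have hf (i : ι) : Measurable (f i) := by
    simp only [f]
    split_ifs <;> fun_prop
  have hlaw (i : ι) : (gaussianReal 0 (v i)).withDensity (f i) =
      (gaussianReal 0 (v i)).map fun x => x + if i ∈ s then t * v i else 0 := by
    rw [gaussianReal_map_add_const]
    by_cases hi : i ∈ s
    · simpa [f, hi] using gaussianReal_withDensity_exp 0 t (v i)
    · simp [f, hi]
  have (i : ι) : IsProbabilityMeasure ((gaussianReal 0 (v i)).withDensity (f i)) := by
    rw [hlaw]
    exact Measure.isProbabilityMeasure_map (by fun_prop)
  have hprod := infinitePi_withDensity_prod (μ := fun i => gaussianReal 0 (v i)) hf (s := s)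
    fun i hi => by simp [f, hi]
  simp only [hlaw] at hprod
  rw [Measure.infinitePi_map_pi (f := fun i x => x + if i ∈ s then t * v i else 0) _
    fun i => by fun_prop, ← hprod]
  congr 1
  ext x
  exact Finset.prod_congr rfl fun i hi => by simp [f, hi]

end CameronMartin

section PowerSeries

open PowerSeries

variable {𝕜 : Type*} [RCLike 𝕜]

/-- The power series of `z ↦ exp (c * z ^ k)`. -/
noncomputable def expMonomial (k : ℕ+) (c : 𝕜) : PowerSeries 𝕜 :=
  PowerSeries.mk fun m => if (k : ℕ) ∣ m then c ^ (m / k) / (Nat.factorial (m / k) : 𝕜) else 0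

theorem coeff_expMonomial (k : ℕ+) (c : 𝕜) (m : ℕ) : coeff m (expMonomial k c) =
    if (k : ℕ) ∣ m then c ^ (m / k) / (Nat.factorial (m / k) : 𝕜) else 0 :=
  coeff_mk m _

theorem coeff_mul_expMonomial (k : ℕ+) (c : 𝕜) (j : ℕ) :
    coeff (k * j) (expMonomial k c) = c ^ j / (Nat.factorial j : 𝕜) := by
  rw [coeff_expMonomial, if_pos (dvd_mul_right _ _), Nat.mul_div_cancel_left j k.pos]

theorem norm_coeff_expMonomial (k : ℕ+) (c : 𝕜) (m : ℕ) :
    ‖coeff m (expMonomial k c)‖ = coeff m (expMonomial k ‖c‖) := by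
  rw [coeff_expMonomial, coeff_expMonomial]
  split_ifs <;> simp

theorem hasSum_expMonomial (k : ℕ+) (c z : 𝕜) :
    HasSum (fun m => coeff m (expMonomial k c) * z ^ m) (NormedSpace.exp (c * z ^ (k : ℕ))) := by
  have hinj : Function.Injective fun j : ℕ => (k : ℕ) * j :=
    fun _ _ h => Nat.eq_of_mul_eq_mul_left k.pos h
  rw [← hinj.hasSum_iff]
  · convert NormedSpace.expSeries_div_hasSum_exp (c * z ^ (k : ℕ)) using 1
    ext j
    rw [Function.comp_apply, coeff_mul_expMonomial, mul_pow, pow_mul]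
    ring
  · intro m hm
    rw [coeff_expMonomial, if_neg, zero_mul]
    rintro ⟨j, rfl⟩
    exact hm ⟨j, rfl⟩

theorem summable_norm_expMonomial (k : ℕ+) (c z : 𝕜) :
    Summable fun m => ‖coeff m (expMonomial k c) * z ^ m‖ := by
  simpa [norm_mul, norm_coeff_expMonomial] using (hasSum_expMonomial k ‖c‖ ‖z‖).summable

theorem X_mul_derivative_expMonomial (k : ℕ+) (c : 𝕜) :
    X * d⁄dX 𝕜 (expMonomial k c) = C ((k : ℕ) * c) * X ^ (k : ℕ) * expMonomial k c := by
  ext m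
  rw [mul_assoc, coeff_C_mul, coeff_X_pow_mul']
  rcases m with _ | m
  · simp
  rw [coeff_succ_X_mul, coeff_derivative]
  by_cases hdvd : (k : ℕ) ∣ m + 1
  · obtain ⟨_ | j, hj⟩ := hdvd
    · simp at hj
    have hle : (k : ℕ) ≤ m + 1 := hj ▸ Nat.le_mul_of_pos_right _ j.succ_pos
    have hsub : m + 1 - k = k * j := by rw [hj, Nat.mul_succ, Nat.add_sub_cancel]
    have hcast : (m : 𝕜) + 1 = (k : ℕ) * ((j : 𝕜) + 1) := by exact_mod_cast hj
    have hj0 : (j : 𝕜) + 1 ≠ 0 := Nat.cast_add_one_ne_zero j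
    rw [if_pos hle, hsub, hj, coeff_mul_expMonomial, coeff_mul_expMonomial, hcast,
      Nat.factorial_succ, pow_succ]
    push_cast
    field_simp
  · rw [coeff_expMonomial, if_neg hdvd, zero_mul]
    split_ifs with hle
    · rw [coeff_expMonomial, if_neg fun h => hdvd ?_, mul_zero]
      exact (Nat.dvd_sub_iff_left hle dvd_rfl).1 h
    · rw [mul_zero]

/-- The power series of `z ↦ exp (∑ k ∈ s, c k * z ^ k)`. -/
noncomputable def expPoly (s : Finset ℕ+) (c : ℕ+ → 𝕜) : PowerSeries 𝕜 :=
  ∏ k ∈ s, expMonomial k (c k)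

theorem expPoly_insert [DecidableEq ℕ+] {s : Finset ℕ+} {k : ℕ+} (hk : k ∉ s) (c : ℕ+ → 𝕜) :
    expPoly (insert k s) c = expMonomial k (c k) * expPoly s c :=
  Finset.prod_insert hk

theorem expPoly_union {s t : Finset ℕ+} (h : Disjoint s t) (c : ℕ+ → 𝕜) :
    expPoly (s ∪ t) c = expPoly s c * expPoly t c :=
  Finset.prod_union h

theorem coeff_mul_mul_pow (f g : PowerSeries 𝕜) (z : 𝕜) (m : ℕ) :
    coeff m (f * g) * z ^ m = ∑ p ∈ Finset.HasAntidiagonal.antidiagonal m,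
      (coeff p.1 f * z ^ p.1) * (coeff p.2 g * z ^ p.2) := by
  rw [coeff_mul, Finset.sum_mul]
  refine Finset.sum_congr rfl fun p hp => ?_
  rw [← Finset.HasAntidiagonal.mem_antidiagonal.1 hp, pow_add]
  ring

theorem summable_norm_coeff_mul {f g : PowerSeries 𝕜} {z : 𝕜}
    (hf : Summable fun m => ‖coeff m f * z ^ m‖) (hg : Summable fun m => ‖coeff m g * z ^ m‖) :
    Summable fun m => ‖coeff m (f * g) * z ^ m‖ := by
  simp only [coeff_mul_mul_pow]
  exact summable_norm_sum_mul_antidiagonal_of_summable_norm (f := fun m => coeff m f * z ^ m)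
    (g := fun m => coeff m g * z ^ m) hf hg

theorem tsum_coeff_mul {f g : PowerSeries 𝕜} {z : 𝕜}
    (hf : Summable fun m => ‖coeff m f * z ^ m‖) (hg : Summable fun m => ‖coeff m g * z ^ m‖) :
    ∑' m, coeff m (f * g) * z ^ m = (∑' m, coeff m f * z ^ m) * ∑' m, coeff m g * z ^ m := by
  simp only [coeff_mul_mul_pow]
  exact (tsum_mul_tsum_eq_tsum_sum_antidiagonal_of_summable_norm hf hg).symm

theorem summable_norm_expPoly (s : Finset ℕ+) (c : ℕ+ → 𝕜) (z : 𝕜) :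
    Summable fun m => ‖coeff m (expPoly s c) * z ^ m‖ := by
  induction s using Finset.induction_on with
  | empty =>
    refine summable_of_ne_finset_zero (s := {0}) fun m hm => ?_
    simp [expPoly, coeff_one, Finset.notMem_singleton.1 hm]
  | insert k s hk ih =>
    rw [expPoly_insert hk]
    exact summable_norm_coeff_mul (summable_norm_expMonomial k (c k) z) ih

theorem tsum_expPoly (s : Finset ℕ+) (c : ℕ+ → 𝕜) (z : 𝕜) :
    ∑' m, coeff m (expPoly s c) * z ^ m = NormedSpace.exp (∑ k ∈ s, c k * z ^ (k : ℕ)) := by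
  induction s using Finset.induction_on with
  | empty =>
    rw [tsum_eq_single 0 fun m hm => by simp [expPoly, coeff_one, hm]]
    simp [expPoly]
  | insert k s hk ih =>
    rw [expPoly_insert hk,
      tsum_coeff_mul (summable_norm_expMonomial k (c k) z) (summable_norm_expPoly s c z),
      (hasSum_expMonomial k (c k) z).tsum_eq, ih, Finset.sum_insert hk, NormedSpace.exp_add]

theorem hasSum_expPoly (s : Finset ℕ+) (c : ℕ+ → 𝕜) (z : 𝕜) :
    HasSum (fun m => coeff m (expPoly s c) * z ^ m)
      (NormedSpace.exp (∑ k ∈ s, c k * z ^ (k : ℕ))) :=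
  tsum_expPoly s c z ▸ (summable_norm_expPoly s c z).of_norm.hasSum

theorem X_mul_derivative_expPoly (s : Finset ℕ+) (c : ℕ+ → 𝕜) :
    X * d⁄dX 𝕜 (expPoly s c) = (∑ k ∈ s, C ((k : ℕ) * c k) * X ^ (k : ℕ)) * expPoly s c := by
  induction s using Finset.induction_on with
  | empty => simp [expPoly]
  | insert k s hk ih =>
    rw [expPoly_insert hk, Derivation.leibniz, Finset.sum_insert hk, smul_eq_mul, smul_eq_mul]
    linear_combination expMonomial k (c k) * ih +
      expPoly s c * X_mul_derivative_expMonomial k (c k)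

theorem natCast_mul_coeff_expPoly (s : Finset ℕ+) (c : ℕ+ → 𝕜) (m : ℕ) :
    (m : 𝕜) * coeff m (expPoly s c) =
      ∑ k ∈ s.filter fun k : ℕ+ => (k : ℕ) ≤ m, (k : ℕ) * c k * coeff (m - k) (expPoly s c) := by
  have hcoeff : coeff m (X * d⁄dX 𝕜 (expPoly s c)) = m * coeff m (expPoly s c) := by
    rcases m with _ | m
    · simp
    · rw [coeff_succ_X_mul, coeff_derivative, mul_comm, Nat.cast_succ]
  rw [← hcoeff, X_mul_derivative_expPoly, Finset.sum_mul, map_sum, Finset.sum_filter]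
  refine Finset.sum_congr rfl fun k _ => ?_
  rw [mul_assoc, coeff_C_mul, coeff_X_pow_mul', mul_ite, mul_zero]

theorem coeff_zero_expPoly (s : Finset ℕ+) (c : ℕ+ → 𝕜) : coeff 0 (expPoly s c) = 1 := by
  rw [coeff_zero_eq_constantCoeff_apply, expPoly, map_prod]
  refine Finset.prod_eq_one fun k _ => ?_
  simpa using coeff_mul_expMonomial k (c k) 0

theorem coeff_expPoly_eq_zero {s : Finset ℕ+} (c : ℕ+ → 𝕜) {m : ℕ} (hm : m ≠ 0)
    (hs : ∀ k ∈ s, m < (k : ℕ)) : coeff m (expPoly s c) = 0 := by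
  have h := natCast_mul_coeff_expPoly s c m
  rw [Finset.filter_false_of_mem fun k hk => not_le.2 (hs k hk), Finset.sum_empty] at h
  exact (mul_eq_zero.1 h).resolve_left (by exact_mod_cast hm)

theorem coeff_expPoly_of_subset {s t : Finset ℕ+} (hst : s ⊆ t) (c : ℕ+ → 𝕜) {m : ℕ}
    (h : ∀ k ∈ t, (k : ℕ) ≤ m → k ∈ s) : coeff m (expPoly t c) = coeff m (expPoly s c) := by
  have hsplit : expPoly t c = expPoly s c * expPoly (t \ s) c := by
    rw [← expPoly_union Finset.disjoint_sdiff, Finset.union_sdiff_of_subset hst]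
  rw [hsplit, coeff_mul, Finset.sum_eq_single (m, 0)]
  · rw [coeff_zero_expPoly, mul_one]
  · rintro ⟨i, j⟩ hij hne
    have hsum : i + j = m := Finset.HasAntidiagonal.mem_antidiagonal.1 hij
    have hj : j ≠ 0 := by
      rintro rfl
      exact hne (by rw [← hsum, add_zero])
    rw [coeff_expPoly_eq_zero c hj, mul_zero]
    intro k hk
    by_contra! hkj
    exact (Finset.mem_sdiff.1 hk).2 (h k (Finset.mem_sdiff.1 hk).1 (by lia))
  · simp

theorem coeff_expPoly_nonneg (s : Finset ℕ+) {c : ℕ+ → ℝ} (hc : ∀ k, 0 ≤ c k) (m : ℕ) :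
    0 ≤ coeff m (expPoly s c) := by
  induction s using Finset.induction_on generalizing m with
  | empty =>
    rw [expPoly, Finset.prod_empty, coeff_one]
    positivity
  | insert k s hk ih =>
    rw [expPoly_insert hk, coeff_mul]
    refine Finset.sum_nonneg fun p _ => mul_nonneg ?_ (ih _)
    rw [← Real.norm_of_nonneg (hc k), ← norm_coeff_expMonomial]
    exact norm_nonneg _

/-- The coefficient of `z ^ m` in `exp (∑ k ∈ s, z ^ k / k)`: the variance of the `m`-th coefficient
of the chaos restricted to the frequencies in `s`. -/
noncomputable def varCoeff (s : Finset ℕ+) (m : ℕ) : ℝ :=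
  coeff m (expPoly s fun k => ((k : ℕ) : ℝ)⁻¹)

theorem varCoeff_nonneg (s : Finset ℕ+) (m : ℕ) : 0 ≤ varCoeff s m :=
  coeff_expPoly_nonneg s (fun _ => by positivity) m

theorem natCast_mul_varCoeff (s : Finset ℕ+) (m : ℕ) :
    m * varCoeff s m = ∑ k ∈ s.filter fun k : ℕ+ => (k : ℕ) ≤ m, varCoeff s (m - k) := by
  rw [varCoeff, natCast_mul_coeff_expPoly]
  refine Finset.sum_congr rfl fun k _ => ?_
  rw [mul_inv_cancel₀ (Nat.cast_ne_zero.2 k.ne_zero), one_mul, varCoeff]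

theorem card_filter_pnat_le (s : Finset ℕ+) (m : ℕ) :
    (s.filter fun k : ℕ+ => (k : ℕ) ≤ m).card ≤ m := by
  have hle : (s.filter fun k : ℕ+ => (k : ℕ) ≤ m).card ≤ (Finset.Icc 1 m).card :=
    Finset.card_le_card_of_injOn (fun k : ℕ+ => (k : ℕ))
      (fun k hk => Finset.mem_Icc.2 ⟨k.pos, (Finset.mem_filter.1 hk).2⟩) PNat.coe_injective.injOn
  simpa using hle

theorem varCoeff_le_one (s : Finset ℕ+) (m : ℕ) : varCoeff s m ≤ 1 := by
  induction m using Nat.strong_induction_on with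
  | _ m ih =>
  rcases m.eq_zero_or_pos with rfl | hm
  · rw [varCoeff, coeff_zero_expPoly]
  refine le_of_mul_le_mul_left ?_ (Nat.cast_pos.2 hm : (0 : ℝ) < m)
  calc (m : ℝ) * varCoeff s m = ∑ k ∈ s.filter fun k : ℕ+ => (k : ℕ) ≤ m, varCoeff s (m - k) :=
        natCast_mul_varCoeff s m
    _ ≤ ∑ _k ∈ s.filter fun k : ℕ+ => (k : ℕ) ≤ m, (1 : ℝ) :=
        Finset.sum_le_sum fun k _ => ih _ (Nat.sub_lt hm k.pos)
    _ = (s.filter fun k : ℕ+ => (k : ℕ) ≤ m).card := by simp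
    _ ≤ m * 1 := by rw [mul_one]; exact_mod_cast card_filter_pnat_le s m

theorem hasSum_varCoeff (s : Finset ℕ+) (x : ℝ) : HasSum (fun m => varCoeff s m * x ^ m)
    (Real.exp (∑ k ∈ s, x ^ (k : ℕ) / (k : ℕ))) := by
  have hexponent : ∑ k ∈ s, x ^ (k : ℕ) / (k : ℕ) = ∑ k ∈ s, ((k : ℕ) : ℝ)⁻¹ * x ^ (k : ℕ) :=
    Finset.sum_congr rfl fun k _ => div_eq_inv_mul _ _
  rw [Real.exp_eq_exp_ℝ, hexponent]
  exact hasSum_expPoly s (fun k => ((k : ℕ) : ℝ)⁻¹) x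

variable {s : Finset ℕ+} {x A : ℝ}

theorem sum_varCoeff_sub_mul_pow_le (hx : 0 ≤ x) (m : ℕ) :
    ∑ k ∈ s.filter fun k : ℕ+ => (k : ℕ) ≤ m, varCoeff s (m - k) * x ^ (m - (k : ℕ)) ≤
      Real.exp (∑ k ∈ s, x ^ (k : ℕ) / (k : ℕ)) := by
  rw [← Finset.sum_image (f := fun l => varCoeff s l * x ^ l) (g := fun k : ℕ+ => m - (k : ℕ))]
  · exact sum_le_hasSum _ (fun l _ => mul_nonneg (varCoeff_nonneg s l) (pow_nonneg hx l))
      (hasSum_varCoeff s x)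
  · intro a ha b hb hab
    have ha' := (Finset.mem_filter.1 ha).2
    have hb' := (Finset.mem_filter.1 hb).2
    exact PNat.coe_injective (by simp only at hab; lia)

theorem natCast_mul_varCoeff_mul_pow_le (hx : 0 ≤ x) (hA : ∀ k ∈ s, x ^ (k : ℕ) ≤ A)
    (hA0 : 0 ≤ A) (m : ℕ) :
    m * (varCoeff s m * x ^ m) ≤ A * Real.exp (∑ k ∈ s, x ^ (k : ℕ) / (k : ℕ)) :=
  calc m * (varCoeff s m * x ^ m)
      = ∑ k ∈ s.filter fun k : ℕ+ => (k : ℕ) ≤ m,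
          x ^ (k : ℕ) * (varCoeff s (m - k) * x ^ (m - (k : ℕ))) := by
        rw [← mul_assoc, natCast_mul_varCoeff, Finset.sum_mul]
        refine Finset.sum_congr rfl fun k hk => ?_
        rw [mul_left_comm, ← pow_add, Nat.add_sub_cancel' (Finset.mem_filter.1 hk).2]
    _ ≤ ∑ k ∈ s.filter fun k : ℕ+ => (k : ℕ) ≤ m, A * (varCoeff s (m - k) * x ^ (m - (k : ℕ))) := by
        gcongr with k hk
        · exact mul_nonneg (varCoeff_nonneg s _) (pow_nonneg hx _)
        · exact hA k (Finset.mem_filter.1 hk).1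
    _ ≤ _ := by
        rw [← Finset.mul_sum]
        exact mul_le_mul_of_nonneg_left (sum_varCoeff_sub_mul_pow_le hx m) hA0

theorem varCoeff_mul_pow_le {K : ℕ} (hK : 0 < K) (hs : ∀ k ∈ s, K ≤ (k : ℕ))
    (hsum : ∑ k ∈ s, (((k : ℕ) : ℝ))⁻¹ ≤ 1) (hx : 0 ≤ x) (hA : ∀ k ∈ s, x ^ (k : ℕ) ≤ A)
    (hA0 : 0 ≤ A) {m : ℕ} (hm : m ≠ 0) : varCoeff s m * x ^ m ≤ A * Real.exp A / K := by
  rcases lt_or_ge m K with hmK | hKm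
  · rw [varCoeff, coeff_expPoly_eq_zero _ hm fun k hk => hmK.trans_le (hs k hk), zero_mul]
    positivity
  have hexponent : ∑ k ∈ s, x ^ (k : ℕ) / (k : ℕ) ≤ A :=
    calc ∑ k ∈ s, x ^ (k : ℕ) / (k : ℕ) ≤ ∑ k ∈ s, A * (((k : ℕ) : ℝ))⁻¹ := by
          simp only [div_eq_mul_inv]
          gcongr with k hk
          exact hA k hk
      _ ≤ A := by
          rw [← Finset.mul_sum]
          exact mul_le_of_le_one_right hA0 hsum
  have hnonneg : 0 ≤ varCoeff s m * x ^ m := mul_nonneg (varCoeff_nonneg s m) (pow_nonneg hx m)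
  rw [le_div_iff₀' (Nat.cast_pos.2 hK)]
  calc K * (varCoeff s m * x ^ m) ≤ m * (varCoeff s m * x ^ m) := by gcongr
    _ ≤ A * Real.exp (∑ k ∈ s, x ^ (k : ℕ) / (k : ℕ)) :=
        natCast_mul_varCoeff_mul_pow_le hx hA hA0 m
    _ ≤ A * Real.exp A := by gcongr

end PowerSeries

section ComplexGaussian

/-- The standard complex Gaussian distribution, with density `π⁻¹ * exp (-‖z‖ ^ 2)`. -/
noncomputable def stdComplexGaussian : Measure ℂ :=
  volume.withDensity fun z => ENNReal.ofReal (Real.pi⁻¹ * Real.exp (-‖z‖ ^ 2))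

theorem integral_stdComplexGaussian (f : ℂ → ℂ) : ∫ z, f z ∂stdComplexGaussian =
    ∫ z : ℂ, (Real.pi⁻¹ * Real.exp (-‖z‖ ^ 2)) • f z := by
  rw [stdComplexGaussian,
    integral_withDensity_eq_integral_toReal_smul (by fun_prop) (by simp)]
  refine integral_congr_ae (.of_forall fun z => ?_)
  beta_reduce
  rw [ENNReal.toReal_ofReal (by positivity)]

instance isProbabilityMeasure_stdComplexGaussian : IsProbabilityMeasure stdComplexGaussian := by
  have hinteg : ∫ z : ℂ, Real.exp (-‖z‖ ^ 2) = Real.pi := by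
    simpa [Complex.finrank_real_complex] using
      GaussianFourier.integral_rexp_neg_mul_sq_norm (V := ℂ) one_pos
  have hintegrable : Integrable fun z : ℂ => Real.exp (-‖z‖ ^ 2) :=
    not_imp_comm.1 integral_undef (hinteg ▸ Real.pi_ne_zero)
  refine ⟨?_⟩
  rw [stdComplexGaussian, withDensity_apply _ .univ, setLIntegral_univ,
    ← ofReal_integral_eq_lintegral_ofReal (hintegrable.const_mul _)
      (.of_forall fun z => by positivity), integral_const_mul, hinteg,
    inv_mul_cancel₀ Real.pi_ne_zero, ENNReal.ofReal_one]

theorem charFun_stdComplexGaussian (t : ℂ) :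
    charFun stdComplexGaussian t = Complex.exp (-(‖t‖ ^ 2 / 4 : ℝ)) := by
  have hfourier := GaussianFourier.integral_cexp_neg_mul_sq_norm_add (V := ℂ) (b := 1) (by simp)
    Complex.I t
  rw [charFun_apply, integral_stdComplexGaussian]
  calc ∫ z : ℂ, (Real.pi⁻¹ * Real.exp (-‖z‖ ^ 2)) • Complex.exp (inner ℝ z t * Complex.I)
      = (Real.pi : ℂ)⁻¹ *
          ∫ z : ℂ, Complex.exp (-1 * ‖z‖ ^ 2 + Complex.I * inner ℝ t z) := by
        rw [← integral_const_mul]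
        refine integral_congr_ae (.of_forall fun z => ?_)
        simp only [Complex.real_smul, Complex.exp_add, real_inner_comm]
        push_cast
        ring_nf
    _ = _ := by
        rw [hfourier, Complex.finrank_real_complex]
        simp only [Nat.cast_ofNat, div_one, div_self (two_ne_zero (α := ℂ)), Complex.cpow_one]
        rw [inv_mul_cancel_left₀ (Complex.ofReal_ne_zero.2 Real.pi_ne_zero)]
        push_cast
        rw [Complex.I_sq]
        ring_nf

theorem charFun_map_re_mul {Ω : Type*} {mΩ : MeasurableSpace Ω} {μ : Measure Ω} {Z : Ω → ℂ}
    (hZ : AEMeasurable Z μ) (w : ℂ) (s : ℝ) :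
    charFun (μ.map fun ω => (w * Z ω).re) s = charFun (μ.map Z) (s * (starRingEnd ℂ) w) := by
  rw [charFun_apply, charFun_apply, integral_map (by fun_prop) (by fun_prop),
    integral_map hZ (by fun_prop)]
  refine integral_congr_ae (.of_forall fun ω => ?_)
  simp only [Complex.inner, RCLike.inner_apply, conj_trivial, Complex.ofReal_mul]
  congr 2
  simp only [Complex.mul_re, Complex.ofReal_sub, Complex.ofReal_mul, Complex.ofReal_re,
    Complex.conj_re, Complex.ofReal_im, Complex.conj_im, mul_neg, zero_mul, neg_zero, sub_zero,
    Complex.mul_im, add_zero, neg_mul, neg_neg]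
  ring

theorem map_re_mul_stdComplexGaussian (w : ℂ) :
    stdComplexGaussian.map (fun z => (w * z).re) = gaussianReal 0 (‖w‖₊ ^ 2 / 2) := by
  refine Measure.ext_of_charFun (funext fun s => ?_)
  rw [charFun_map_re_mul (Z := fun z => z) (by fun_prop), Measure.map_id',
    charFun_stdComplexGaussian, charFun_gaussianReal]
  congr 1
  simp only [Complex.norm_mul, Complex.norm_real, Real.norm_eq_abs, RCLike.norm_conj, mul_pow,
    sq_abs, Complex.ofReal_div, Complex.ofReal_mul, Complex.ofReal_pow, Complex.ofReal_ofNat,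
    Complex.ofReal_zero, mul_zero, zero_mul, NNReal.coe_div, NNReal.coe_pow, coe_nnnorm,
    NNReal.coe_ofNat, zero_sub, neg_inj]
  ring

/- Rotating `z` by an angle `π / (m - l)` changes the sign of the integrand. -/
theorem integral_pow_mul_conj_pow_of_ne {m l : ℕ} (h : m ≠ l) :
    ∫ z, z ^ m * (starRingEnd ℂ) z ^ l ∂stdComplexGaussian = 0 := by
  set u := Circle.exp (Real.pi / (m - l)) with hu
  have hne : (m : ℂ) - l ≠ 0 := sub_ne_zero.2 (Nat.cast_injective.ne h)
  have hphase : (u : ℂ) ^ m * (starRingEnd ℂ) (u : ℂ) ^ l = -1 := by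
    rw [hu, Circle.coe_exp, ← Complex.exp_conj, ← Complex.exp_nat_mul, ← Complex.exp_nat_mul,
      ← Complex.exp_add, ← Complex.exp_pi_mul_I]
    congr 1
    simp only [map_mul, Complex.conj_ofReal, Complex.conj_I]
    push_cast
    field_simp
    ring
  have hrotation := (rotation u).measurePreserving.integral_comp
    (rotation u).toHomeomorph.measurableEmbedding
    (fun z : ℂ => (Real.pi⁻¹ * Real.exp (-‖z‖ ^ 2)) • (z ^ m * (starRingEnd ℂ) z ^ l))
  rw [integral_stdComplexGaussian, ← self_eq_neg, ← integral_neg]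
  refine hrotation.symm.trans (integral_congr_ae (.of_forall fun z => ?_))
  simp only [rotation_apply, norm_mul, Circle.norm_coe, one_mul, map_mul, mul_pow, ← smul_neg]
  congr 1
  linear_combination z ^ m * (starRingEnd ℂ) z ^ l * hphase

theorem integral_pow_mul_conj_pow_self (m : ℕ) :
    ∫ z, z ^ m * (starRingEnd ℂ) z ^ m ∂stdComplexGaussian = m.factorial := by
  have hintegrand (z : ℂ) : (Real.pi⁻¹ * Real.exp (-‖z‖ ^ 2)) • (z ^ m * (starRingEnd ℂ) z ^ m) =
      ((Real.pi⁻¹ * (‖z‖ ^ (2 * m : ℝ) * Real.exp (-‖z‖ ^ (2 : ℝ))) : ℝ) : ℂ) := by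
    have hpow : ‖z‖ ^ (2 * m : ℝ) = (‖z‖ ^ 2) ^ m := by
      rw [← pow_mul]
      exact_mod_cast Real.rpow_natCast ‖z‖ (2 * m)
    rw [← mul_pow, Complex.mul_conj, Complex.normSq_eq_norm_sq, Complex.real_smul, hpow,
      Real.rpow_two]
    push_cast
    ring
  have hexponent : -2 < 2 * (m : ℝ) := by linarith [m.cast_nonneg (α := ℝ)]
  rw [integral_stdComplexGaussian]
  simp only [hintegrand]
  rw [integral_complex_ofReal, integral_const_mul,
    Complex.integral_rpow_mul_exp_neg_rpow one_le_two hexponent,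
    show (2 * (m : ℝ) + 2) / 2 = m + 1 by ring, Real.Gamma_nat_eq_factorial,
    mul_div_cancel_left₀ _ two_ne_zero, inv_mul_cancel_left₀ Real.pi_ne_zero,
    Complex.ofReal_natCast]

theorem integral_pow_mul_conj_pow_stdComplexGaussian (m l : ℕ) :
    ∫ z, z ^ m * (starRingEnd ℂ) z ^ l ∂stdComplexGaussian =
      if m = l then (m.factorial : ℂ) else 0 := by
  split_ifs with h
  · rw [← h, integral_pow_mul_conj_pow_self]
  · exact integral_pow_mul_conj_pow_of_ne h

theorem integrable_pow_mul_conj_pow_stdComplexGaussian (m l : ℕ) :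
    Integrable (fun z => z ^ m * (starRingEnd ℂ) z ^ l) stdComplexGaussian := by
  have heven : Integrable (fun z => z ^ (m + l) * (starRingEnd ℂ) z ^ (m + l))
      stdComplexGaussian := by
    refine not_imp_comm.1 integral_undef ?_
    rw [integral_pow_mul_conj_pow_self]
    exact_mod_cast (m + l).factorial_ne_zero
  refine ((integrable_const 1).add heven.norm).mono' (by fun_prop) (.of_forall fun z => ?_)
  simp only [Pi.add_apply, norm_mul, norm_pow, RCLike.norm_conj, ← pow_add]
  rw [pow_add ‖z‖ (m + l)]
  nlinarith [sq_nonneg (‖z‖ ^ (m + l) - 1), sq_nonneg (‖z‖ ^ (m + l))]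

namespace IsStdComplexGaussian

variable {Ω : Type*} {mΩ : MeasurableSpace Ω} {μ : Measure Ω} {Z : Ω → ℂ}

theorem integral_re_mul (h : IsStdComplexGaussian Z μ) (w : ℂ) : ∫ ω, (w * Z ω).re ∂μ = 0 := by
  rw [← Complex.zero_re, ← mul_zero w, ← h.mean, ← integral_const_mul]
  exact integral_re (h.gaussian.integrable.const_mul w)

theorem integral_re_mul_sq (h : IsStdComplexGaussian Z μ) (w : ℂ) :
    ∫ ω, (w * Z ω).re ^ 2 ∂μ = ‖w‖ ^ 2 / 2 := by
  have hsq_re (ω : Ω) : (w * Z ω).re ^ 2 = (‖w‖ ^ 2 * ‖Z ω‖ ^ 2 + (w ^ 2 * Z ω ^ 2).re) / 2 := by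
    rw [← mul_pow, ← mul_pow, ← norm_mul, Complex.sq_norm, Complex.normSq_apply, sq (w * Z ω),
      Complex.mul_re (w * Z ω)]
    ring
  have hsq : Integrable (fun ω => w ^ 2 * Z ω ^ 2) μ := by
    simp only [sq (Z _)]
    exact (h.gaussian.memLp_two.integrable_mul h.gaussian.memLp_two).const_mul _
  have hnorm : Integrable (fun ω => ‖Z ω‖ ^ 2) μ :=
    h.gaussian.memLp_two.integrable_norm_pow two_ne_zero
  have hre : ∫ ω, (w ^ 2 * Z ω ^ 2).re ∂μ = 0 := by
    rw [← Complex.zero_re, ← mul_zero (w ^ 2), ← h.sq_mean, ← integral_const_mul]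
    exact integral_re hsq
  simp only [hsq_re]
  rw [integral_div, integral_add (g := fun ω => (w ^ 2 * Z ω ^ 2).re) (hnorm.const_mul _) hsq.re,
    integral_const_mul, h.normSq_mean, hre, add_zero, mul_one]

theorem map_re_mul (h : IsStdComplexGaussian Z μ) (w : ℂ) :
    μ.map (fun ω => (w * Z ω).re) = gaussianReal 0 (‖w‖₊ ^ 2 / 2) := by
  have hgaussian : HasGaussianLaw (fun ω => (w * Z ω).re) μ :=
    h.gaussian.map_fun (Complex.reCLM.comp ((ContinuousLinearMap.mul ℂ ℂ w).restrictScalars ℝ))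
  rw [hgaussian.map_eq_gaussianReal, h.integral_re_mul w,
    variance_of_integral_eq_zero hgaussian.aemeasurable (h.integral_re_mul w),
    h.integral_re_mul_sq w]
  congr 1
  ext
  rw [Real.coe_toNNReal _ (by positivity)]
  simp

/- The laws of all `Re (w * Z)` determine the law of `Z`. -/
theorem map_eq_stdComplexGaussian (h : IsStdComplexGaussian Z μ) :
    μ.map Z = stdComplexGaussian := by
  have := h.gaussian.isProbabilityMeasure
  have : IsProbabilityMeasure (μ.map Z) :=
    Measure.isProbabilityMeasure_map h.gaussian.aemeasurable
  refine Measure.ext_of_charFun (funext fun t => ?_)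
  have hconj : t = (1 : ℝ) * (starRingEnd ℂ) ((starRingEnd ℂ) t) := by simp
  rw [hconj, ← charFun_map_re_mul h.gaussian.aemeasurable, h.map_re_mul,
    ← map_re_mul_stdComplexGaussian, charFun_map_re_mul (Z := fun z => z) (by fun_prop),
    Measure.map_id']

end IsStdComplexGaussian

/-- The law of a sequence of independent standard complex Gaussian variables. -/
noncomputable def gaussianSeq : Measure (ℕ+ → ℂ) :=
  Measure.infinitePi fun _ => stdComplexGaussian

instance isProbabilityMeasure_gaussianSeq : IsProbabilityMeasure gaussianSeq :=
  inferInstanceAs (IsProbabilityMeasure (Measure.infinitePi _))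

end ComplexGaussian

section Circle

theorem integral_circleMap_pow_mul_conj (r : ℝ) (m n : ℕ) :
    ∫ t in (0 : ℝ)..2 * Real.pi, circleMap 0 r t ^ m * (starRingEnd ℂ) (circleMap 0 r t ^ n) =
      if m = n then 2 * Real.pi * (r : ℂ) ^ (2 * n) else 0 := by
  have hphase (t : ℝ) : circleMap 0 r t ^ m * (starRingEnd ℂ) (circleMap 0 r t ^ n) =
      (r : ℂ) ^ (m + n) * Complex.exp (Complex.I * (m - n) * t) := by
    have hexp : Complex.I * (m - n) * t = m * (t * Complex.I) + n * (t * -Complex.I) := by ring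
    rw [circleMap_zero, map_pow, map_mul, Complex.conj_ofReal, ← Complex.exp_conj, map_mul,
      Complex.conj_ofReal, Complex.conj_I, mul_pow, mul_pow, ← Complex.exp_nat_mul,
      ← Complex.exp_nat_mul, hexp, Complex.exp_add, pow_add]
    ring
  simp only [hphase]
  rw [intervalIntegral.integral_const_mul]
  split_ifs with h
  · rw [h, sub_self, mul_zero, ← two_mul]
    simp only [zero_mul, Complex.exp_zero, intervalIntegral.integral_const, sub_zero,
      Complex.real_smul, mul_one]
    push_cast
    ring
  · have hne : Complex.I * ((m : ℂ) - n) ≠ 0 :=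
      mul_ne_zero Complex.I_ne_zero (sub_ne_zero.2 (Nat.cast_injective.ne h))
    have hperiod : Complex.exp (Complex.I * (m - n) * ((2 * Real.pi : ℝ) : ℂ)) = 1 := by
      rw [Complex.exp_eq_one_iff]
      exact ⟨(m : ℤ) - n, by push_cast; ring⟩
    rw [integral_exp_mul_complex hne, hperiod]
    simp

variable {a : ℕ → ℂ} {r : ℝ} {f : ℝ → ℂ}

theorem hasSum_integral_circleMap_pow_mul (hr : 0 ≤ r) (ha : Summable fun m => ‖a m‖ * r ^ m)
    (hf : ∀ t, HasSum (fun m => a m * circleMap 0 r t ^ m) (f t)) {g : ℝ → ℂ} (hg : Continuous g) :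
    HasSum (fun m => a m * ∫ t in (0 : ℝ)..2 * Real.pi, circleMap 0 r t ^ m * g t)
      (∫ t in (0 : ℝ)..2 * Real.pi, f t * g t) := by
  simp only [← intervalIntegral.integral_const_mul, ← mul_assoc]
  refine intervalIntegral.hasSum_integral_of_dominated_convergence
    (fun m t => ‖a m‖ * r ^ m * ‖g t‖) (fun m => Continuous.aestronglyMeasurable (by fun_prop))
    (fun m => .of_forall fun t _ => ?_) (.of_forall fun t _ => ha.mul_right _) ?_
    (.of_forall fun t _ => (hf t).mul_right _)
  · rw [norm_mul, norm_mul, norm_pow, norm_circleMap_zero, abs_of_nonneg hr]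
  · simp only [tsum_mul_right]
    exact Continuous.intervalIntegrable (by fun_prop) _ _

theorem integral_mul_conj_circleMap_pow (hr : 0 ≤ r) (ha : Summable fun m => ‖a m‖ * r ^ m)
    (hf : ∀ t, HasSum (fun m => a m * circleMap 0 r t ^ m) (f t)) (n : ℕ) :
    ∫ t in (0 : ℝ)..2 * Real.pi, f t * (starRingEnd ℂ) (circleMap 0 r t ^ n) =
      2 * Real.pi * (a n * r ^ (2 * n)) := by
  have hsum := hasSum_integral_circleMap_pow_mul hr ha hf
    (g := fun t => (starRingEnd ℂ) (circleMap 0 r t ^ n)) (by fun_prop)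
  simp only [integral_circleMap_pow_mul_conj, mul_ite, mul_zero] at hsum
  rw [hsum.unique (hasSum_single n fun m hm => if_neg hm), if_pos rfl]
  ring

theorem hasSum_norm_sq_mul_pow_circleMap (hr : 0 ≤ r) (ha : Summable fun m => ‖a m‖ * r ^ m)
    (hf : ∀ t, HasSum (fun m => a m * circleMap 0 r t ^ m) (f t)) (hfc : Continuous f) :
    HasSum (fun m => 2 * Real.pi * (‖a m‖ ^ 2 * r ^ (2 * m)))
      (∫ t in (0 : ℝ)..2 * Real.pi, ‖f t‖ ^ 2) := by
  have hsum := hasSum_integral_circleMap_pow_mul hr ha hf (g := fun t => (starRingEnd ℂ) (f t))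
    (by fun_prop)
  rw [← Complex.hasSum_ofReal]
  convert hsum using 1
  · ext m
    have hconj : ∫ t in (0 : ℝ)..2 * Real.pi, circleMap 0 r t ^ m * (starRingEnd ℂ) (f t) =
        (starRingEnd ℂ) (2 * Real.pi * (a m * r ^ (2 * m))) := by
      rw [← integral_mul_conj_circleMap_pow hr ha hf m, ← intervalIntegral.intervalIntegral_conj]
      refine intervalIntegral.integral_congr fun t _ => ?_
      simp only [map_mul, RCLike.conj_conj, mul_comm]
    rw [hconj]
    simp only [map_mul, map_pow, Complex.conj_ofReal, map_ofNat]
    push_cast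
    rw [← Complex.mul_conj']
    ring
  · rw [← intervalIntegral.integral_ofReal]
    refine intervalIntegral.integral_congr fun t _ => ?_
    simp only [Complex.mul_conj', Complex.ofReal_pow]

end Circle

section IndependentConvolution

open Finset.HasAntidiagonal (antidiagonal mem_antidiagonal)

variable {Ω : Type*} {mΩ : MeasurableSpace Ω} {μ : Measure Ω} {u v : ℕ → Ω → ℂ}

theorem indepFun_mul_conj (huv : IndepFun (fun ω i => u i ω) (fun ω i => v i ω) μ)
    (i i' j j' : ℕ) : IndepFun (fun ω => u i ω * (starRingEnd ℂ) (u i' ω))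
      (fun ω => v j ω * (starRingEnd ℂ) (v j' ω)) μ :=
  huv.comp (φ := fun x : ℕ → ℂ => x i * (starRingEnd ℂ) (x i'))
    (ψ := fun x : ℕ → ℂ => x j * (starRingEnd ℂ) (x j')) (by fun_prop) (by fun_prop)

theorem integrable_mul_conj {f g : Ω → ℂ} (hf : MemLp f 2 μ) (hg : MemLp g 2 μ) :
    Integrable (fun ω => f ω * (starRingEnd ℂ) (g ω)) μ :=
  hf.integrable_mul hg.star

theorem memLp_sum_mul (hu : ∀ i, MemLp (u i) 2 μ) (hv : ∀ i, MemLp (v i) 2 μ)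
    (huv : IndepFun (fun ω i => u i ω) (fun ω i => v i ω) μ) (A : Finset (ℕ × ℕ)) :
    MemLp (fun ω => ∑ p ∈ A, u p.1 ω * v p.2 ω) 2 μ := by
  refine memLp_finsetSum _ fun p _ => ?_
  have hsq : IndepFun (fun ω => ‖u p.1 ω‖ ^ 2) (fun ω => ‖v p.2 ω‖ ^ 2) μ :=
    huv.comp (φ := fun x : ℕ → ℂ => ‖x p.1‖ ^ 2) (ψ := fun x : ℕ → ℂ => ‖x p.2‖ ^ 2)
      (by fun_prop) (by fun_prop)
  rw [memLp_two_iff_integrable_sq_norm ((hu p.1).1.fun_mul (hv p.2).1)]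
  simp only [norm_mul, mul_pow]
  exact hsq.integrable_mul ((memLp_two_iff_integrable_sq_norm (hu _).1).1 (hu _))
    ((memLp_two_iff_integrable_sq_norm (hv _).1).1 (hv _))

theorem integral_sum_mul_mul_conj (hu : ∀ i, MemLp (u i) 2 μ) (hv : ∀ i, MemLp (v i) 2 μ)
    (huv : IndepFun (fun ω i => u i ω) (fun ω i => v i ω) μ) (A B : Finset (ℕ × ℕ)) :
    ∫ ω, (∑ p ∈ A, u p.1 ω * v p.2 ω) * (starRingEnd ℂ) (∑ q ∈ B, u q.1 ω * v q.2 ω) ∂μ =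
      ∑ p ∈ A, ∑ q ∈ B, (∫ ω, u p.1 ω * (starRingEnd ℂ) (u q.1 ω) ∂μ) *
        ∫ ω, v p.2 ω * (starRingEnd ℂ) (v q.2 ω) ∂μ := by
  have hexpand (ω : Ω) : (∑ p ∈ A, u p.1 ω * v p.2 ω) *
      (starRingEnd ℂ) (∑ q ∈ B, u q.1 ω * v q.2 ω) = ∑ p ∈ A, ∑ q ∈ B,
        (u p.1 ω * (starRingEnd ℂ) (u q.1 ω)) * (v p.2 ω * (starRingEnd ℂ) (v q.2 ω)) := by
    simp only [map_sum, map_mul, Finset.sum_mul_sum, mul_mul_mul_comm]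
  have hinteg (p q : ℕ × ℕ) : Integrable (fun ω => (u p.1 ω * (starRingEnd ℂ) (u q.1 ω)) *
      (v p.2 ω * (starRingEnd ℂ) (v q.2 ω))) μ :=
    (indepFun_mul_conj huv _ _ _ _).integrable_mul (integrable_mul_conj (hu _) (hu _))
      (integrable_mul_conj (hv _) (hv _))
  simp only [hexpand]
  rw [integral_finsetSum _ fun p _ => integrable_finsetSum _ fun q _ => hinteg p q]
  refine Finset.sum_congr rfl fun p _ => ?_
  rw [integral_finsetSum _ fun q _ => hinteg p q]
  exact Finset.sum_congr rfl fun q _ =>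
    (indepFun_mul_conj huv _ _ _ _).integral_fun_mul_eq_mul_integral
      (integrable_mul_conj (hu _) (hu _)).aestronglyMeasurable
      (integrable_mul_conj (hv _) (hv _)).aestronglyMeasurable

theorem integral_norm_sum_mul_sq (hu : ∀ i, MemLp (u i) 2 μ) (hv : ∀ i, MemLp (v i) 2 μ)
    (huv : IndepFun (fun ω i => u i ω) (fun ω i => v i ω) μ) {V : ℕ → ℝ}
    (hvV : ∀ i j, ∫ ω, v i ω * (starRingEnd ℂ) (v j ω) ∂μ = if i = j then (V i : ℂ) else 0)
    {A : Finset (ℕ × ℕ)} (hA : Set.InjOn Prod.snd (A : Set (ℕ × ℕ))) :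
    ∫ ω, ‖∑ p ∈ A, u p.1 ω * v p.2 ω‖ ^ 2 ∂μ = ∑ p ∈ A, V p.2 * ∫ ω, ‖u p.1 ω‖ ^ 2 ∂μ := by
  rw [← Complex.ofReal_inj, ← integral_complex_ofReal]
  simp only [Complex.ofReal_pow, ← Complex.mul_conj']
  rw [integral_sum_mul_mul_conj hu hv huv, Complex.ofReal_sum]
  refine Finset.sum_congr rfl fun p hp => ?_
  rw [Finset.sum_eq_single_of_mem p hp fun q hq hqp => by
    rw [hvV, if_neg (hA.ne hp hq hqp.symm), mul_zero], hvV, if_pos rfl]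
  simp only [Complex.mul_conj', Complex.ofReal_mul, ← integral_complex_ofReal, Complex.ofReal_pow]
  ring

theorem sum_antidiagonal_sum_antidiagonal_ite {R : Type*} [NonUnitalNonAssocSemiring R]
    (a b : ℕ → R) (m l : ℕ) :
    ∑ p ∈ antidiagonal m, ∑ q ∈ antidiagonal l,
      (if p.1 = q.1 then a p.1 else 0) * (if p.2 = q.2 then b p.2 else 0) =
    if m = l then ∑ p ∈ antidiagonal m, a p.1 * b p.2 else 0 := by
  simp only [ite_zero_mul_ite_zero, ← Prod.ext_iff, Finset.sum_ite_eq, mem_antidiagonal]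
  split_ifs with h
  · exact Finset.sum_congr rfl fun p hp => if_pos (h ▸ mem_antidiagonal.1 hp)
  · exact Finset.sum_eq_zero fun p hp => if_neg (mem_antidiagonal.1 hp ▸ h)

end IndependentConvolution

section ChaosCoeff

open PowerSeries
open Finset.HasAntidiagonal (antidiagonal mem_antidiagonal)

/-- The coefficient of `z ^ m` in `exp (∑ k ∈ s, z ^ k / √k * x k)`. -/
noncomputable def chaosCoeff (s : Finset ℕ+) (x : ℕ+ → ℂ) (m : ℕ) : ℂ :=
  coeff m (expPoly s fun k => x k / (√((k : ℕ) : ℝ) : ℂ))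

theorem chaosCoeff_zero (s : Finset ℕ+) (x : ℕ+ → ℂ) : chaosCoeff s x 0 = 1 :=
  coeff_zero_expPoly s _

theorem chaosCoeff_insert {k : ℕ+} {s : Finset ℕ+} (hk : k ∉ s) (x : ℕ+ → ℂ) (m : ℕ) :
    chaosCoeff (insert k s) x m = ∑ p ∈ antidiagonal m,
      coeff p.1 (expMonomial k (x k / (√((k : ℕ) : ℝ) : ℂ))) * chaosCoeff s x p.2 := by
  rw [chaosCoeff, expPoly_insert hk, coeff_mul]
  rfl

theorem chaosCoeff_union {s t : Finset ℕ+} (h : Disjoint s t) (x : ℕ+ → ℂ) (m : ℕ) :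
    chaosCoeff (s ∪ t) x m = ∑ p ∈ antidiagonal m,
      chaosCoeff s x p.1 * chaosCoeff t x p.2 := by
  rw [chaosCoeff, expPoly_union h, coeff_mul]
  rfl

theorem chaosCoeff_union_sub {s t : Finset ℕ+} (h : Disjoint s t) (x : ℕ+ → ℂ) (m : ℕ) :
    chaosCoeff (s ∪ t) x m - chaosCoeff s x m =
      ∑ p ∈ (antidiagonal m).filter fun p => p.2 ≠ 0,
        chaosCoeff s x p.1 * chaosCoeff t x p.2 := by
  have hfilter : ((antidiagonal m).filter fun p => ¬p.2 ≠ 0) = {(m, 0)} := by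
    ext ⟨i, j⟩
    simp only [Finset.mem_filter, mem_antidiagonal, not_not, Finset.mem_singleton,
      Prod.mk.injEq]
    omega
  rw [chaosCoeff_union h, ← Finset.sum_filter_add_sum_filter_not _ (fun p : ℕ × ℕ => p.2 ≠ 0),
    hfilter, Finset.sum_singleton, chaosCoeff_zero, mul_one, add_sub_cancel_right]

theorem dependsOn_chaosCoeff (s : Finset ℕ+) : DependsOn (chaosCoeff s) (s : Set ℕ+) :=
  fun _ _ h => funext fun m => congrArg (coeff m) <|
    Finset.prod_congr rfl fun k hk => congrArg (fun c => expMonomial k (c / _)) (h k hk)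

theorem measurable_coeff_expMonomial (k : ℕ+) (m : ℕ) :
    Measurable fun x : ℕ+ → ℂ => coeff m (expMonomial k (x k / (√((k : ℕ) : ℝ) : ℂ))) := by
  simp only [coeff_expMonomial]
  split_ifs <;> fun_prop

@[fun_prop]
theorem measurable_chaosCoeff (s : Finset ℕ+) (m : ℕ) : Measurable fun x => chaosCoeff s x m := by
  classical
  induction s using Finset.induction_on generalizing m with
  | empty => exact measurable_const
  | insert k s hk ih =>
    simp only [chaosCoeff_insert hk]
    exact Finset.measurable_fun_sum _ fun p _ => (measurable_coeff_expMonomial k _).mul (ih _)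

theorem memLp_pow_stdComplexGaussian (m : ℕ) : MemLp (fun z : ℂ => z ^ m) 2 stdComplexGaussian := by
  rw [memLp_two_iff_integrable_sq_norm (by fun_prop)]
  refine (integrable_pow_mul_conj_pow_stdComplexGaussian m m).norm.congr (.of_forall fun z => ?_)
  simp only [norm_mul, norm_pow, RCLike.norm_conj, sq]

theorem measurePreserving_eval_gaussianSeq (k : ℕ+) :
    MeasurePreserving (fun x : ℕ+ → ℂ => x k) gaussianSeq stdComplexGaussian :=
  measurePreserving_eval_infinitePi _ k

theorem memLp_coeff_expMonomial (k : ℕ+) (m : ℕ) :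
    MemLp (fun x : ℕ+ → ℂ => coeff m (expMonomial k (x k / (√((k : ℕ) : ℝ) : ℂ)))) 2
      gaussianSeq := by
  simp only [coeff_expMonomial]
  split_ifs
  · simp only [div_eq_mul_inv, mul_pow]
    exact (((memLp_pow_stdComplexGaussian _).comp_measurePreserving
      (measurePreserving_eval_gaussianSeq k)).mul_const _).mul_const _
  · exact MemLp.zero

theorem integral_coeff_expMonomial_mul_conj (k : ℕ+) (m l : ℕ) :
    ∫ x, coeff m (expMonomial k (x k / (√((k : ℕ) : ℝ) : ℂ))) *
      (starRingEnd ℂ) (coeff l (expMonomial k (x k / (√((k : ℕ) : ℝ) : ℂ)))) ∂gaussianSeq =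
      if m = l then ((coeff m (expMonomial k (((k : ℕ) : ℝ)⁻¹)) : ℝ) : ℂ) else 0 := by
  by_cases hm : (k : ℕ) ∣ m; swap
  · simp [coeff_expMonomial, hm]
  by_cases hl : (k : ℕ) ∣ l; swap
  · have hne : m ≠ l := fun h => hl (h ▸ hm)
    simp [coeff_expMonomial, hl, hne]
  obtain ⟨i, rfl⟩ := hm
  obtain ⟨j, rfl⟩ := hl
  set w : ℂ := (√((k : ℕ) : ℝ) : ℂ)
  have hw : w * w = ((k : ℕ) : ℂ) := by
    rw [← Complex.ofReal_mul, Real.mul_self_sqrt (Nat.cast_nonneg _), Complex.ofReal_natCast]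
  have hmonomial (x : ℕ+ → ℂ) : (x k / w) ^ i / (i.factorial : ℂ) *
      (starRingEnd ℂ) ((x k / w) ^ j / (j.factorial : ℂ)) =
      (w ^ i * w ^ j * i.factorial * j.factorial)⁻¹ *
        (x k ^ i * (starRingEnd ℂ) (x k) ^ j) := by
    simp only [map_div₀, map_pow, w, Complex.conj_ofReal, map_natCast, div_pow]
    rw [mul_inv, mul_inv, mul_inv]
    ring
  have hmoment : ∫ x, x k ^ i * (starRingEnd ℂ) (x k) ^ j ∂gaussianSeq =
      ∫ z, z ^ i * (starRingEnd ℂ) z ^ j ∂stdComplexGaussian := by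
    rw [← (measurePreserving_eval_gaussianSeq k).map_eq]
    exact (integral_map (measurePreserving_eval_gaussianSeq k).aemeasurable
      (f := fun z : ℂ => z ^ i * (starRingEnd ℂ) z ^ j) (by fun_prop)).symm
  simp only [coeff_mul_expMonomial, hmonomial]
  rw [integral_const_mul, hmoment, integral_pow_mul_conj_pow_stdComplexGaussian, mul_ite, mul_zero]
  simp only [Nat.mul_right_inj k.ne_zero]
  split_ifs with hij
  · have hfact : (i.factorial : ℂ) ≠ 0 := Nat.cast_ne_zero.2 i.factorial_ne_zero
    have hk : ((k : ℕ) : ℂ) ≠ 0 := Nat.cast_ne_zero.2 k.ne_zero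
    rw [← hij, ← mul_pow, hw, Complex.ofReal_div, Complex.ofReal_pow, Complex.ofReal_inv, inv_pow,
      Complex.ofReal_natCast, Complex.ofReal_natCast]
    field_simp
  · rfl

theorem indepFun_coeff_expMonomial_chaosCoeff {k : ℕ+} {s : Finset ℕ+} (hk : k ∉ s) :
    IndepFun (fun x i => coeff i (expMonomial k (x k / (√((k : ℕ) : ℝ) : ℂ)))) (chaosCoeff s)
      gaussianSeq := by
  refine indepFun_infinitePi_of_dependsOn (Finset.disjoint_singleton_left.2 hk)
    (measurable_pi_lambda _ fun i => measurable_coeff_expMonomial k i)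
    (measurable_pi_lambda _ fun i => measurable_chaosCoeff s i) (fun x y h => ?_)
    (dependsOn_chaosCoeff s)
  rw [h k (Finset.mem_coe.2 (Finset.mem_singleton_self k))]

theorem memLp_chaosCoeff (s : Finset ℕ+) (m : ℕ) :
    MemLp (fun x => chaosCoeff s x m) 2 gaussianSeq := by
  classical
  induction s using Finset.induction_on generalizing m with
  | empty => exact memLp_const _
  | insert k s hk ih =>
    simp only [chaosCoeff_insert hk]
    exact memLp_sum_mul (memLp_coeff_expMonomial k) ih (indepFun_coeff_expMonomial_chaosCoeff hk) _

theorem integral_chaosCoeff_mul_conj (s : Finset ℕ+) (m l : ℕ) :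
    ∫ x, chaosCoeff s x m * (starRingEnd ℂ) (chaosCoeff s x l) ∂gaussianSeq =
      if m = l then (varCoeff s m : ℂ) else 0 := by
  classical
  induction s using Finset.induction_on generalizing m l with
  | empty =>
    simp only [chaosCoeff, varCoeff, expPoly, Finset.prod_empty, coeff_one, integral_const,
      probReal_univ, one_smul]
    split_ifs <;> simp_all
  | insert k s hk ih =>
    simp only [chaosCoeff_insert hk]
    rw [integral_sum_mul_mul_conj (memLp_coeff_expMonomial k) (memLp_chaosCoeff s)
      (indepFun_coeff_expMonomial_chaosCoeff hk)]
    simp only [integral_coeff_expMonomial_mul_conj, ih]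
    rw [sum_antidiagonal_sum_antidiagonal_ite
      (fun i => ((coeff i (expMonomial k (((k : ℕ) : ℝ)⁻¹)) : ℝ) : ℂ))
      (fun i => (varCoeff s i : ℂ)), varCoeff, expPoly_insert hk, coeff_mul, Complex.ofReal_sum]
    simp only [Complex.ofReal_mul, varCoeff]

theorem integrable_norm_chaosCoeff_sq (s : Finset ℕ+) (m : ℕ) :
    Integrable (fun x => ‖chaosCoeff s x m‖ ^ 2) gaussianSeq :=
  (memLp_two_iff_integrable_sq_norm (memLp_chaosCoeff s m).1).1 (memLp_chaosCoeff s m)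

theorem integral_norm_chaosCoeff_sq (s : Finset ℕ+) (m : ℕ) :
    ∫ x, ‖chaosCoeff s x m‖ ^ 2 ∂gaussianSeq = varCoeff s m := by
  have h := integral_chaosCoeff_mul_conj s m m
  simp only [Complex.mul_conj', if_true, ← Complex.ofReal_pow] at h
  rw [integral_complex_ofReal] at h
  exact Complex.ofReal_inj.1 h

theorem setIntegral_norm_chaosCoeff_sub_sq {s t : Finset ℕ+} (hst : Disjoint s t)
    {E : Set (ℕ+ → ℂ)} (hE : MeasurableSet E) (hEs : DependsOn (· ∈ E) (s : Set ℕ+)) (n : ℕ) :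
    ∫ x in E, ‖chaosCoeff (s ∪ t) x n - chaosCoeff s x n‖ ^ 2 ∂gaussianSeq =
    ∑ p ∈ (antidiagonal n).filter fun p => p.2 ≠ 0, varCoeff t p.2 *
      ∫ x in E, ‖chaosCoeff s x p.1‖ ^ 2 ∂gaussianSeq := by
  classical
  have hmeas (i : ℕ) : Measurable (E.indicator fun x => chaosCoeff s x i) :=
    (measurable_chaosCoeff s i).indicator hE
  have hdep : DependsOn (fun x i => E.indicator (fun x => chaosCoeff s x i) x) (s : Set ℕ+) :=
    fun x y h => by simp only [Set.indicator_apply, hEs h, dependsOn_chaosCoeff s h]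
  have hindep : IndepFun (fun x i => E.indicator (fun x => chaosCoeff s x i) x) (chaosCoeff t)
      gaussianSeq :=
    indepFun_infinitePi_of_dependsOn hst (measurable_pi_lambda _ hmeas)
      (measurable_pi_lambda _ fun i => measurable_chaosCoeff t i) hdep (dependsOn_chaosCoeff t)
  have hinj : Set.InjOn Prod.snd
      (((antidiagonal n).filter fun p => p.2 ≠ 0 : Finset (ℕ × ℕ)) : Set (ℕ × ℕ)) := by
    intro p hp q hq h
    simp only [Finset.coe_filter, mem_antidiagonal, Set.mem_ofPred_eq] at hp hq
    exact Prod.ext (by omega) h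
  have h := integral_norm_sum_mul_sq (fun i => (memLp_chaosCoeff s i).indicator hE)
    (memLp_chaosCoeff t) hindep (integral_chaosCoeff_mul_conj t) hinj
  simp only [← integral_indicator hE, chaosCoeff_union_sub hst]
  convert h using 1
  · refine integral_congr_ae (.of_forall fun x => ?_)
    by_cases hx : x ∈ E <;> simp [hx]
  · refine Finset.sum_congr rfl fun p _ => congrArg _ (integral_congr_ae (.of_forall fun x => ?_))
    by_cases hx : x ∈ E <;> simp [hx]

end ChaosCoeff

section Frequencies

/-- The frequencies below `2 ^ i`. -/
def lowFreq (i : ℕ) : Finset ℕ+ := Finset.Ico 1 (2 ^ i)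

/-- The dyadic block of frequencies in `[2 ^ i, 2 ^ (i + 1))`. -/
def blockFreq (i : ℕ) : Finset ℕ+ := Finset.Ico (2 ^ i) (2 ^ (i + 1))

theorem mem_lowFreq {i : ℕ} {k : ℕ+} : k ∈ lowFreq i ↔ (k : ℕ) < 2 ^ i := by
  rw [lowFreq, Finset.mem_Ico, ← PNat.coe_lt_coe]
  simp

theorem mem_blockFreq {i : ℕ} {k : ℕ+} :
    k ∈ blockFreq i ↔ 2 ^ i ≤ (k : ℕ) ∧ (k : ℕ) < 2 ^ (i + 1) := by
  rw [blockFreq, Finset.mem_Ico, ← PNat.coe_lt_coe, ← PNat.coe_le_coe]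
  simp

theorem lowFreq_zero : lowFreq 0 = ∅ := by
  ext k
  simp [mem_lowFreq]

theorem lowFreq_mono : Monotone lowFreq := fun _ _ h _ hk =>
  mem_lowFreq.2 ((mem_lowFreq.1 hk).trans_le (Nat.pow_le_pow_right two_pos h))

theorem blockFreq_subset_lowFreq {i j : ℕ} (h : i < j) : blockFreq i ⊆ lowFreq j := fun _ hk =>
  lowFreq_mono h (mem_lowFreq.2 (mem_blockFreq.1 hk).2)

theorem lowFreq_succ (i : ℕ) : lowFreq (i + 1) = lowFreq i ∪ blockFreq i := by
  ext k
  rw [Finset.mem_union, mem_lowFreq, mem_lowFreq, mem_blockFreq]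
  have := Nat.pow_lt_pow_succ (a := 2) (n := i) one_lt_two
  omega

theorem disjoint_lowFreq_blockFreq (i : ℕ) : Disjoint (lowFreq i) (blockFreq i) :=
  Finset.disjoint_left.2 fun _ hk hk' =>
    (mem_lowFreq.1 hk).not_ge (mem_blockFreq.1 hk').1

theorem pairwise_disjoint_blockFreq : Pairwise fun i j => Disjoint (blockFreq i) (blockFreq j) :=
  (pairwise_disjoint_on blockFreq).2 fun _ j hij =>
    (disjoint_lowFreq_blockFreq j).mono_left (blockFreq_subset_lowFreq hij)

theorem sum_lowFreq {α : Type*} [AddCommMonoid α] (f : ℕ+ → α) (i : ℕ) :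
    ∑ k ∈ lowFreq i, f k = ∑ l ∈ Finset.range i, ∑ k ∈ blockFreq l, f k := by
  induction i with
  | zero => simp [lowFreq_zero]
  | succ i ih =>
    rw [lowFreq_succ, Finset.sum_union (disjoint_lowFreq_blockFreq i), ih, Finset.sum_range_succ]

theorem tendsto_lowFreq : Filter.Tendsto lowFreq Filter.atTop Filter.atTop :=
  Filter.tendsto_atTop_finset_of_monotone lowFreq_mono fun k =>
    ⟨k, mem_lowFreq.2 Nat.lt_two_pow_self⟩

theorem card_blockFreq (i : ℕ) : (blockFreq i).card = 2 ^ i := by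
  rw [blockFreq, PNat.card_Ico, PNat.pow_coe, PNat.pow_coe, PNat.val_ofNat, pow_succ, mul_two,
    Nat.add_sub_cancel]

theorem chaosCoeff_lowFreq_eq {i j n : ℕ} (hij : i ≤ j) (hn : n < 2 ^ i) (x : ℕ+ → ℂ) :
    chaosCoeff (lowFreq j) x n = chaosCoeff (lowFreq i) x n :=
  coeff_expPoly_of_subset (lowFreq_mono hij) _ fun _ _ hk => mem_lowFreq.2 (hk.trans_lt hn)

end Frequencies

section HmcCoeff

/-- The exponent of the chaos restricted to the frequencies in `s`. -/
noncomputable def partialField (s : Finset ℕ+) (x : ℕ+ → ℂ) (z : ℂ) : ℂ :=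
  ∑ k ∈ s, x k / (√((k : ℕ) : ℝ) : ℂ) * z ^ (k : ℕ)

@[fun_prop]
theorem continuous_partialField (s : Finset ℕ+) (x : ℕ+ → ℂ) : Continuous (partialField s x) := by
  unfold partialField
  fun_prop

theorem summable_norm_chaosCoeff_mul_pow (s : Finset ℕ+) (x : ℕ+ → ℂ) {r : ℝ} (hr : 0 ≤ r) :
    Summable fun m => ‖chaosCoeff s x m‖ * r ^ m := by
  have := summable_norm_expPoly s (fun k => x k / (√((k : ℕ) : ℝ) : ℂ)) (r : ℂ)
  simpa [chaosCoeff, abs_of_nonneg hr] using this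

theorem hasSum_chaosCoeff_mul_pow (s : Finset ℕ+) (x : ℕ+ → ℂ) (z : ℂ) :
    HasSum (fun m => chaosCoeff s x m * z ^ m) (Complex.exp (partialField s x z)) := by
  rw [Complex.exp_eq_exp_ℂ]
  exact hasSum_expPoly s (fun k => x k / (√((k : ℕ) : ℝ) : ℂ)) z

theorem norm_div_sqrt_mul_pow_le (w z : ℂ) (k : ℕ+) :
    ‖w / (√((k : ℕ) : ℝ) : ℂ) * z ^ (k : ℕ)‖ ≤ ‖w‖ * ‖z‖ ^ (k : ℕ) := by
  have hk : 1 ≤ √((k : ℕ) : ℝ) := Real.one_le_sqrt.2 (Nat.one_le_cast.2 k.pos)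
  rw [norm_mul, norm_pow, norm_div, Complex.norm_real, Real.norm_of_nonneg (Real.sqrt_nonneg _)]
  gcongr
  exact div_le_self (norm_nonneg _) hk

theorem tendsto_partialField_lowFreq {x : ℕ+ → ℂ} {z : ℂ}
    (hx : Summable fun k : ℕ+ => ‖x k‖ * ‖z‖ ^ (k : ℕ)) :
    Filter.Tendsto (fun j => partialField (lowFreq j) x z) Filter.atTop
      (nhds (gaussianSeries x z)) := by
  have hsum : Summable fun k : ℕ+ => x k / (√((k : ℕ) : ℝ) : ℂ) * z ^ (k : ℕ) :=
    .of_norm_bounded hx fun k => norm_div_sqrt_mul_pow_le (x k) z k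
  have hseries : gaussianSeries x z = ∑' k : ℕ+, x k / (√((k : ℕ) : ℝ) : ℂ) * z ^ (k : ℕ) :=
    tsum_congr fun k => by ring
  rw [hseries]
  exact hsum.hasSum.comp tendsto_lowFreq

theorem norm_exp_partialField_le {x : ℕ+ → ℂ} {z : ℂ}
    (hx : Summable fun k : ℕ+ => ‖x k‖ * ‖z‖ ^ (k : ℕ)) (s : Finset ℕ+) :
    ‖Complex.exp (partialField s x z)‖ ≤ Real.exp (∑' k : ℕ+, ‖x k‖ * ‖z‖ ^ (k : ℕ)) := by
  refine (Complex.norm_exp_le_exp_norm _).trans (Real.exp_le_exp.2 ?_)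
  calc ‖partialField s x z‖ ≤ ∑ k ∈ s, ‖x k‖ * ‖z‖ ^ (k : ℕ) :=
        norm_sum_le_of_le _ fun k _ => norm_div_sqrt_mul_pow_le (x k) z k
    _ ≤ ∑' k : ℕ+, ‖x k‖ * ‖z‖ ^ (k : ℕ) := hx.sum_le_tsum s fun k _ => by positivity

theorem integral_exp_gaussianSeries_mul_conj {x : ℕ+ → ℂ} {r : ℝ} (hr : 0 ≤ r)
    (hx : Summable fun k : ℕ+ => ‖x k‖ * r ^ (k : ℕ)) {n i : ℕ} (hn : n < 2 ^ i) :
    ∫ t in (0 : ℝ)..2 * Real.pi, Complex.exp (gaussianSeries x (circleMap 0 r t)) *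
      (starRingEnd ℂ) (circleMap 0 r t ^ n) =
      2 * Real.pi * (chaosCoeff (lowFreq i) x n * r ^ (2 * n)) := by
  have hnorm (t : ℝ) : ‖circleMap 0 r t‖ = r := by rw [norm_circleMap_zero, abs_of_nonneg hr]
  have hx' (t : ℝ) : Summable fun k : ℕ+ => ‖x k‖ * ‖circleMap 0 r t‖ ^ (k : ℕ) := by
    rwa [hnorm]
  have hlim : Filter.Tendsto (fun j => ∫ t in (0 : ℝ)..2 * Real.pi,
      Complex.exp (partialField (lowFreq j) x (circleMap 0 r t)) *
        (starRingEnd ℂ) (circleMap 0 r t ^ n)) Filter.atTop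
      (nhds (∫ t in (0 : ℝ)..2 * Real.pi, Complex.exp (gaussianSeries x (circleMap 0 r t)) *
        (starRingEnd ℂ) (circleMap 0 r t ^ n))) := by
    refine intervalIntegral.tendsto_integral_filter_of_dominated_convergence
      (fun _ => Real.exp (∑' k : ℕ+, ‖x k‖ * r ^ (k : ℕ)) * r ^ n)
      (.of_forall fun j => Continuous.aestronglyMeasurable (by fun_prop))
      (.of_forall fun j => .of_forall fun t _ => ?_) intervalIntegrable_const
      (.of_forall fun t _ => ((tendsto_partialField_lowFreq (hx' t)).cexp).mul_const _)
    have hexp := norm_exp_partialField_le (hx' t) (lowFreq j)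
    rw [norm_mul, RCLike.norm_conj, norm_pow, hnorm]
    rw [hnorm] at hexp
    gcongr
  refine tendsto_nhds_unique hlim (tendsto_const_nhds.congr' ?_)
  filter_upwards [Filter.eventually_ge_atTop i] with j hj
  rw [integral_mul_conj_circleMap_pow hr (summable_norm_chaosCoeff_mul_pow (lowFreq j) x hr)
    (fun t => hasSum_chaosCoeff_mul_pow (lowFreq j) x _), chaosCoeff_lowFreq_eq hj hn]

theorem hmcCoeff_one_eq_chaosCoeff {x : ℕ+ → ℂ}
    (hx : ∀ r : ℝ, 0 ≤ r → r < 1 → Summable fun k : ℕ+ => ‖x k‖ * r ^ (k : ℕ)) {n i : ℕ}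
    (hn : n < 2 ^ i) : hmcCoeff 1 x n = chaosCoeff (lowFreq i) x n := by
  have hcont : Continuous fun r : ℝ => chaosCoeff (lowFreq i) x n * (r : ℂ) ^ (2 * n) := by fun_prop
  have hlim : Filter.Tendsto (fun r : ℝ => chaosCoeff (lowFreq i) x n * (r : ℂ) ^ (2 * n))
      (nhdsWithin 1 (Set.Iio 1)) (nhds (chaosCoeff (lowFreq i) x n)) := by
    simpa using (hcont.tendsto 1).mono_left nhdsWithin_le_nhds
  refine (hlim.congr' ?_).limUnder_eq
  filter_upwards [Ioo_mem_nhdsLT zero_lt_one] with r hr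
  have h := integral_exp_gaussianSeries_mul_conj hr.1.le (hx r hr.1.le hr.2) hn
  simp only [circleMap_zero, mul_comm _ Complex.I] at h
  simp only [Real.sqrt_one, Complex.ofReal_one, one_mul, h]
  field_simp

theorem eLpNorm_smul_eval_gaussianSeq (c : ℝ) (k : ℕ+) :
    eLpNorm (c • fun x : ℕ+ → ℂ => x k) 2 gaussianSeq = ‖c‖ₑ * eLpNorm id 2 stdComplexGaussian := by
  rw [eLpNorm_const_smul, ← eLpNorm_comp_measurePreserving (g := id) aestronglyMeasurable_id
    (measurePreserving_eval_gaussianSeq k)]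
  rfl

/- `∑ ‖x k‖ / k ^ 2` has finite mean. -/
theorem ae_gaussianSeq_exists_norm_le_mul_sq :
    ∀ᵐ x ∂gaussianSeq, ∃ T, ∀ k : ℕ+, ‖x k‖ ≤ T * ((k : ℕ) : ℝ) ^ 2 := by
  have hfinite : eLpNorm id 2 stdComplexGaussian ≠ ⊤ := by
    simpa [Function.id_def] using (memLp_pow_stdComplexGaussian 1).eLpNorm_ne_top
  have hinv : Summable fun k : ℕ+ => (((k : ℕ) : ℝ) ^ 2)⁻¹ :=
    (Real.summable_nat_pow_inv.2 one_lt_two).comp_injective PNat.coe_injective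
  have hmean : ∑' k : ℕ+,
      eLpNorm ((((k : ℕ) : ℝ) ^ 2)⁻¹ • fun x : ℕ+ → ℂ => x k) 2 gaussianSeq ≠ ⊤ := by
    simp_rw [eLpNorm_smul_eval_gaussianSeq, ENNReal.tsum_mul_right, Real.enorm_eq_ofReal_abs]
    exact ENNReal.mul_ne_top hinv.abs.tsum_ofReal_ne_top hfinite
  filter_upwards [summable_norm_of_tsum_eLpNorm_ne_top one_le_two
    (fun k => ((measurable_pi_apply k).const_smul _).aestronglyMeasurable) hmean] with x hx
  refine ⟨∑' k : ℕ+, ‖(((k : ℕ) : ℝ) ^ 2)⁻¹ • x k‖, fun k => ?_⟩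
  have hk : (0 : ℝ) < ((k : ℕ) : ℝ) ^ 2 := by have := k.pos; positivity
  have hle : ‖(((k : ℕ) : ℝ) ^ 2)⁻¹ • x k‖ ≤ _ := hx.le_tsum k fun l _ => norm_nonneg _
  rwa [norm_smul, norm_inv, Real.norm_of_nonneg hk.le, inv_mul_le_iff₀ hk, mul_comm] at hle

theorem ae_gaussianSeq_summable_norm_mul_pow :
    ∀ᵐ x ∂gaussianSeq, ∀ r : ℝ, 0 ≤ r → r < 1 → Summable fun k : ℕ+ => ‖x k‖ * r ^ (k : ℕ) := by
  filter_upwards [ae_gaussianSeq_exists_norm_le_mul_sq] with x ⟨T, hT⟩ r hr0 hr1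
  have hgeom : Summable fun n : ℕ => T * ((n : ℝ) ^ 2 * r ^ n) :=
    (summable_pow_mul_geometric_of_norm_lt_one 2 (by rwa [Real.norm_of_nonneg hr0])).mul_left T
  refine .of_nonneg_of_le (fun k => by positivity) (fun k => ?_)
    (hgeom.comp_injective PNat.coe_injective)
  rw [Function.comp_apply, ← mul_assoc]
  gcongr
  exact hT k

end HmcCoeff

section Energy

theorem sum_lowFreq_inv (j : ℕ) :
    ∑ k ∈ lowFreq j, ((k : ℕ) : ℝ)⁻¹ = ((harmonic (2 ^ j - 1) : ℚ) : ℝ) := by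
  rw [harmonic, Rat.cast_sum]
  refine Finset.sum_bij' (fun k _ => k.natPred) (fun l _ => l.succPNat) ?_ ?_ ?_ ?_ ?_
  · intro k hk
    have hpred := k.natPred_add_one
    have := mem_lowFreq.1 hk
    exact Finset.mem_range.2 (by omega)
  · intro l hl
    have := Finset.mem_range.1 hl
    exact mem_lowFreq.2 (by rw [Nat.succPNat_coe]; omega)
  · exact fun k _ => k.succPNat_natPred
  · exact fun l _ => l.natPred_succPNat
  · intro k _
    rw [← k.natPred_add_one]
    push_cast
    rfl

theorem mul_log_two_le_sum_lowFreq_inv (j : ℕ) :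
    j * Real.log 2 ≤ ∑ k ∈ lowFreq j, ((k : ℕ) : ℝ)⁻¹ := by
  have h := log_add_one_le_harmonic (2 ^ j - 1)
  rwa [Nat.sub_add_cancel Nat.one_le_two_pow, Nat.cast_pow, Nat.cast_ofNat, Real.log_pow,
    ← sum_lowFreq_inv] at h

theorem sum_lowFreq_inv_le (j : ℕ) :
    ∑ k ∈ lowFreq j, ((k : ℕ) : ℝ)⁻¹ ≤ 1 + j * Real.log 2 := by
  have hlog : Real.log (2 ^ j - 1 : ℕ) ≤ j * Real.log 2 := by
    rw [← Real.log_pow]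
    rcases Nat.eq_zero_or_pos (2 ^ j - 1) with h | h
    · rw [h, Nat.cast_zero, Real.log_zero]
      exact Real.log_nonneg (one_le_pow₀ one_le_two)
    · refine Real.log_le_log (Nat.cast_pos.2 h) ?_
      exact_mod_cast Nat.sub_le (2 ^ j) 1
  rw [sum_lowFreq_inv]
  linarith [harmonic_le_one_add_log (2 ^ j - 1)]

theorem sum_blockFreq_inv_le_one (l : ℕ) : ∑ k ∈ blockFreq l, ((k : ℕ) : ℝ)⁻¹ ≤ 1 := by
  calc ∑ k ∈ blockFreq l, ((k : ℕ) : ℝ)⁻¹ ≤ (blockFreq l).card • ((2 : ℝ) ^ l)⁻¹ := by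
        refine Finset.sum_le_card_nsmul _ _ _ fun k hk => ?_
        have : (2 : ℝ) ^ l ≤ (k : ℕ) := by exact_mod_cast (mem_blockFreq.1 hk).1
        gcongr
    _ = 1 := by
        rw [card_blockFreq, nsmul_eq_mul]
        push_cast
        field_simp

theorem half_le_sum_blockFreq_inv (l : ℕ) : 1 / 2 ≤ ∑ k ∈ blockFreq l, ((k : ℕ) : ℝ)⁻¹ := by
  calc (1 / 2 : ℝ) = (blockFreq l).card • ((2 : ℝ) ^ (l + 1))⁻¹ := by
        rw [card_blockFreq, nsmul_eq_mul, pow_succ]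
        push_cast
        field_simp
    _ ≤ ∑ k ∈ blockFreq l, ((k : ℕ) : ℝ)⁻¹ := by
        refine Finset.card_nsmul_le_sum _ _ _ fun k hk => ?_
        have hk : ((k : ℕ) : ℝ) ≤ 2 ^ (l + 1) := by exact_mod_cast (mem_blockFreq.1 hk).2.le
        have := k.pos
        gcongr

theorem exp_div_two_pow_pow_le {a : ℝ} (ha : 0 ≤ a) {j k : ℕ} (hk : k ≤ 2 ^ j) :
    Real.exp (a / 2 ^ j) ^ k ≤ Real.exp a := by
  have hk : (k : ℝ) ≤ 2 ^ j := by exact_mod_cast hk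
  rw [← Real.exp_nat_mul, mul_div_assoc']
  gcongr
  rw [div_le_iff₀ (by positivity), mul_comm]
  gcongr

theorem exp_le_one_add_mul_exp (y : ℝ) : Real.exp y ≤ 1 + y * Real.exp y := by
  have h := mul_le_mul_of_nonneg_right (Real.add_one_le_exp (-y)) (Real.exp_pos y).le
  rw [← Real.exp_add, neg_add_cancel, Real.exp_zero] at h
  linarith

theorem sum_lowFreq_exp_pow_div_le {a : ℝ} (ha : 0 ≤ a) (j : ℕ) :
    ∑ k ∈ lowFreq j, Real.exp (a / 2 ^ j) ^ (k : ℕ) / (k : ℕ) ≤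
      j * Real.log 2 + (1 + a * Real.exp a) := by
  have hterm (k : ℕ+) (hk : k ∈ lowFreq j) : Real.exp (a / 2 ^ j) ^ (k : ℕ) / (k : ℕ) ≤
      ((k : ℕ) : ℝ)⁻¹ + a * Real.exp a / 2 ^ j := by
    have hk0 : (0 : ℝ) < (k : ℕ) := Nat.cast_pos.2 k.pos
    have hpow := exp_div_two_pow_pow_le ha (mem_lowFreq.1 hk).le
    rw [← Real.exp_nat_mul] at hpow ⊢
    rw [div_le_iff₀ hk0]
    calc Real.exp ((k : ℕ) * (a / 2 ^ j))
        ≤ 1 + (k : ℕ) * (a / 2 ^ j) * Real.exp ((k : ℕ) * (a / 2 ^ j)) := exp_le_one_add_mul_exp _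
      _ ≤ 1 + (k : ℕ) * (a / 2 ^ j) * Real.exp a := by gcongr
      _ = (((k : ℕ) : ℝ)⁻¹ + a * Real.exp a / 2 ^ j) * (k : ℕ) := by field_simp
  have hcard : ((lowFreq j).card : ℝ) ≤ 2 ^ j := by
    rw [lowFreq, PNat.card_Ico, PNat.pow_coe]
    exact_mod_cast Nat.sub_le _ _
  calc ∑ k ∈ lowFreq j, Real.exp (a / 2 ^ j) ^ (k : ℕ) / (k : ℕ)
      ≤ ∑ k ∈ lowFreq j, (((k : ℕ) : ℝ)⁻¹ + a * Real.exp a / 2 ^ j) := Finset.sum_le_sum hterm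
    _ = ∑ k ∈ lowFreq j, ((k : ℕ) : ℝ)⁻¹ + (lowFreq j).card * (a * Real.exp a / 2 ^ j) := by
        rw [Finset.sum_add_distrib, Finset.sum_const, nsmul_eq_mul]
    _ ≤ (1 + j * Real.log 2) + 2 ^ j * (a * Real.exp a / 2 ^ j) := by
        gcongr
        exact sum_lowFreq_inv_le j
    _ = j * Real.log 2 + (1 + a * Real.exp a) := by field_simp; ring

theorem exp_sum_lowFreq_exp_pow_div_le {a : ℝ} (ha : 0 ≤ a) (j : ℕ) :
    Real.exp (∑ k ∈ lowFreq j, Real.exp (a / 2 ^ j) ^ (k : ℕ) / (k : ℕ)) ≤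
      Real.exp (1 + a * Real.exp a) * 2 ^ j := by
  refine (Real.exp_le_exp.2 (sum_lowFreq_exp_pow_div_le ha j)).trans_eq ?_
  rw [Real.exp_add, Real.exp_nat_mul, Real.exp_log two_pos, mul_comm]

end Energy

section Spine

variable {z : ℂ}

/-- The increments, along the dyadic blocks, of the real part of the field at `z`. -/
noncomputable def blockField (z : ℂ) (x : ℕ+ → ℂ) (l : ℕ) : ℝ :=
  (partialField (blockFreq l) x z).re

/-- The variance of `blockField z · l` under `gaussianSeq`. -/
noncomputable def blockVar (z : ℂ) (l : ℕ) : NNReal :=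
  ∑ k ∈ blockFreq l, ‖z ^ (k : ℕ) / (√((k : ℕ) : ℝ) : ℂ)‖₊ ^ 2 / 2

theorem two_mul_blockVar (z : ℂ) (l : ℕ) :
    2 * (blockVar z l : ℝ) = ∑ k ∈ blockFreq l, (‖z‖ ^ 2) ^ (k : ℕ) / (k : ℕ) := by
  rw [blockVar, NNReal.coe_sum, Finset.mul_sum]
  refine Finset.sum_congr rfl fun k _ => ?_
  push_cast
  rw [norm_div, Complex.norm_real, Real.norm_of_nonneg (Real.sqrt_nonneg _), div_pow,
    Real.sq_sqrt (Nat.cast_nonneg _), norm_pow]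
  ring

theorem sum_range_two_mul_blockVar (z : ℂ) (j : ℕ) :
    ∑ l ∈ Finset.range j, 2 * (blockVar z l : ℝ) =
      ∑ k ∈ lowFreq j, (‖z‖ ^ 2) ^ (k : ℕ) / (k : ℕ) := by
  simp only [two_mul_blockVar, sum_lowFreq]

theorem inv_le_norm_sq_pow_div (hz : 1 ≤ ‖z‖) (k : ℕ+) :
    ((k : ℕ) : ℝ)⁻¹ ≤ (‖z‖ ^ 2) ^ (k : ℕ) / (k : ℕ) := by
  rw [← one_div]
  gcongr
  exact one_le_pow₀ (one_le_pow₀ hz)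

theorem one_quarter_le_blockVar (hz : 1 ≤ ‖z‖) (l : ℕ) : (1 / 4 : ℝ) ≤ blockVar z l := by
  have := (half_le_sum_blockFreq_inv l).trans
    (Finset.sum_le_sum fun k _ => inv_le_norm_sq_pow_div hz k)
  rw [← two_mul_blockVar] at this
  linarith

theorem mul_log_two_le_sum_two_mul_blockVar (hz : 1 ≤ ‖z‖) (j : ℕ) :
    j * Real.log 2 ≤ ∑ l ∈ Finset.range j, 2 * (blockVar z l : ℝ) := by
  rw [sum_range_two_mul_blockVar]
  exact (mul_log_two_le_sum_lowFreq_inv j).trans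
    (Finset.sum_le_sum fun k _ => inv_le_norm_sq_pow_div hz k)

theorem norm_sq_eq_exp_two_div {i : ℕ} (hz : ‖z‖ = Real.exp (1 / 2 ^ i)) :
    ‖z‖ ^ 2 = Real.exp (2 / 2 ^ i) := by
  rw [hz, ← Real.exp_nat_mul, Nat.cast_ofNat, mul_one_div]

theorem blockVar_le {i l : ℕ} (hz : ‖z‖ = Real.exp (1 / 2 ^ i)) (hl : l < i) :
    (blockVar z l : ℝ) ≤ Real.exp 2 / 2 := by
  have hterm (k : ℕ+) (hk : k ∈ blockFreq l) :
      (‖z‖ ^ 2) ^ (k : ℕ) / (k : ℕ) ≤ Real.exp 2 * ((k : ℕ) : ℝ)⁻¹ := by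
    rw [norm_sq_eq_exp_two_div hz, div_eq_mul_inv]
    gcongr
    exact exp_div_two_pow_pow_le two_pos.le (mem_lowFreq.1 (blockFreq_subset_lowFreq hl hk)).le
  have hsum := two_mul_blockVar z l ▸ Finset.sum_le_sum hterm
  rw [← Finset.mul_sum] at hsum
  nlinarith [sum_blockFreq_inv_le_one l, Real.exp_pos 2]

@[fun_prop]
theorem measurable_partialField (s : Finset ℕ+) (z : ℂ) :
    Measurable fun x : ℕ+ → ℂ => partialField s x z := by
  unfold partialField
  fun_prop

theorem measurable_blockField (z : ℂ) : Measurable (blockField z) := by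
  refine measurable_pi_lambda _ fun l => ?_
  unfold blockField
  fun_prop

theorem dependsOn_blockField (z : ℂ) (l : ℕ) :
    DependsOn (fun x => blockField z x l) (blockFreq l : Set ℕ+) := fun x y h =>
  congrArg Complex.re (Finset.sum_congr rfl fun k hk => by rw [h k (Finset.mem_coe.2 hk)])

theorem sum_range_blockField (z : ℂ) (x : ℕ+ → ℂ) (j : ℕ) :
    ∑ l ∈ Finset.range j, blockField z x l = (partialField (lowFreq j) x z).re := by
  simp only [blockField, ← Complex.re_sum, partialField, ← sum_lowFreq]

theorem map_blockField_apply (z : ℂ) (l : ℕ) :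
    gaussianSeq.map (fun x => blockField z x l) = gaussianReal 0 (blockVar z l) := by
  have hmap : gaussianSeq.map (fun x (k : ℕ+) => (z ^ (k : ℕ) / (√((k : ℕ) : ℝ) : ℂ) * x k).re) =
      Measure.infinitePi fun k : ℕ+ =>
        gaussianReal 0 (‖z ^ (k : ℕ) / (√((k : ℕ) : ℝ) : ℂ)‖₊ ^ 2 / 2) := by
    simp only [← map_re_mul_stdComplexGaussian]
    exact Measure.infinitePi_map_pi _
      (f := fun (k : ℕ+) (w : ℂ) => (z ^ (k : ℕ) / (√((k : ℕ) : ℝ) : ℂ) * w).re)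
      fun k => by fun_prop
  rw [blockVar, ← map_sum_infinitePi_gaussianReal, ← hmap, Measure.map_map (by fun_prop)
    (by fun_prop)]
  congr 1
  ext x
  simp only [blockField, partialField, Complex.re_sum, Function.comp_apply]
  exact Finset.sum_congr rfl fun k _ => by congr 1; ring

theorem map_blockField (z : ℂ) :
    gaussianSeq.map (blockField z) = Measure.infinitePi fun l => gaussianReal 0 (blockVar z l) := by
  have hmeas (l : ℕ) : Measurable fun x => blockField z x l :=
    (measurable_pi_apply l).comp (measurable_blockField z)
  have hindep : iIndepFun (fun l x => blockField z x l) gaussianSeq :=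
    iIndepFun_infinitePi_of_dependsOn pairwise_disjoint_blockFreq hmeas (dependsOn_blockField z)
  simp only [← map_blockField_apply]
  exact hindep.map_fun_eq_infinitePi_map hmeas

theorem ofReal_norm_exp_partialField_sq (z : ℂ) (i : ℕ) (x : ℕ+ → ℂ) :
    ENNReal.ofReal (‖Complex.exp (partialField (lowFreq i) x z)‖ ^ 2) =
      ENNReal.ofReal (Real.exp (∑ k ∈ lowFreq i, (‖z‖ ^ 2) ^ (k : ℕ) / (k : ℕ))) *
        ∏ l ∈ Finset.range i,
          ENNReal.ofReal (Real.exp (2 * blockField z x l - blockVar z l * 2 ^ 2 / 2)) := by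
  rw [← ENNReal.ofReal_prod_of_nonneg fun l _ => (Real.exp_pos _).le,
    ← ENNReal.ofReal_mul (Real.exp_pos _).le, ← Real.exp_sum, ← Real.exp_add, Complex.norm_exp,
    ← Real.exp_nat_mul, ← sum_range_blockField, ← sum_range_two_mul_blockVar,
    ← Finset.sum_add_distrib, Finset.mul_sum]
  congr 2
  exact Finset.sum_congr rfl fun l _ => by push_cast; ring

/- Reweighting by `|exp (field)|²` shifts each Gaussian increment by twice its variance. -/
theorem setLIntegral_norm_exp_partialField_sq (z : ℂ) (i : ℕ) {E : Set (ℕ → ℝ)}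
    (hE : MeasurableSet E) :
    ∫⁻ x in blockField z ⁻¹' E,
      ENNReal.ofReal (‖Complex.exp (partialField (lowFreq i) x z)‖ ^ 2) ∂gaussianSeq =
      ENNReal.ofReal (Real.exp (∑ k ∈ lowFreq i, (‖z‖ ^ 2) ^ (k : ℕ) / (k : ℕ))) *
        (Measure.infinitePi fun l => gaussianReal 0 (blockVar z l))
          ((fun ξ l => ξ l + if l ∈ Finset.range i then 2 * (blockVar z l : ℝ) else 0) ⁻¹' E) := by
  have hdensity : Measurable fun ξ : ℕ → ℝ => ∏ l ∈ Finset.range i,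
      ENNReal.ofReal (Real.exp (2 * ξ l - blockVar z l * 2 ^ 2 / 2)) := by fun_prop
  simp only [ofReal_norm_exp_partialField_sq]
  rw [lintegral_const_mul _ (by exact hdensity.comp (measurable_blockField z)),
    ← setLIntegral_map hE hdensity (measurable_blockField z), map_blockField,
    ← withDensity_apply _ hE, infinitePi_gaussianReal_withDensity_exp,
    Measure.map_apply (by fun_prop) hE]

/-- The event that the field at `z` stays below the barrier `L + j log 2 + log (j + 1)` at all
dyadic scales `j ≤ i`. -/
def fieldBelow (L : ℝ) (i : ℕ) (z : ℂ) : Set (ℕ+ → ℂ) :=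
  {x | ∀ j ≤ i, (partialField (lowFreq j) x z).re ≤ L + j * Real.log 2 + Real.log (j + 1)}

/- After the shift the walk has drift at least `log 2` per scale, which absorbs the slope of the
barrier: the ballot estimate applies. -/
theorem exists_setLIntegral_fieldBelow_norm_exp_sq_le :
    ∃ C : ℝ, 0 < C ∧ ∀ (i : ℕ) (z : ℂ), ‖z‖ = Real.exp (1 / 2 ^ i) → ∀ {L : ℝ}, 0 ≤ L →
      ∫⁻ x in fieldBelow L i z,
        ENNReal.ofReal (‖Complex.exp (partialField (lowFreq i) x z)‖ ^ 2) ∂gaussianSeq ≤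
        ENNReal.ofReal (C * 2 ^ i * ((1 + L) / √(i + 1))) := by
  obtain ⟨C, hC0, hC⟩ := exists_barrierProb_le (Real.exp 2 / 2)
  refine ⟨Real.exp (1 + 2 * Real.exp 2) * C, by positivity, fun i z hz L hL => ?_⟩
  have hz1 : 1 ≤ ‖z‖ := hz ▸ Real.one_le_exp (by positivity)
  set E : Set (ℕ → ℝ) :=
    {ξ | ∀ j ≤ i, ∑ l ∈ Finset.range j, ξ l ≤ L + j * Real.log 2 + Real.log (j + 1)}
  have hE : MeasurableSet E := by
    simp only [E, Set.ofPred_forall]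
    exact .iInter fun j => .iInter fun _ => measurableSet_le (by fun_prop) measurable_const
  have hfield : fieldBelow L i z = blockField z ⁻¹' E := by
    ext x
    simp only [fieldBelow, E, Set.mem_ofPred_eq, Set.mem_preimage, sum_range_blockField]
  have hshift : (fun ξ l => ξ l + if l ∈ Finset.range i then 2 * (blockVar z l : ℝ) else 0) ⁻¹' E ⊆
      belowBarrier L i := by
    intro ξ hξ j hj
    have hdrift : ∑ l ∈ Finset.range j, (if l ∈ Finset.range i then 2 * (blockVar z l : ℝ) else 0) =
        ∑ l ∈ Finset.range j, 2 * (blockVar z l : ℝ) :=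
      Finset.sum_congr rfl fun l hl => if_pos (Finset.range_mono hj hl)
    have hbelow := hξ j hj
    rw [Finset.sum_add_distrib, hdrift] at hbelow
    linarith [mul_log_two_le_sum_two_mul_blockVar hz1 j]
  have hballot := hC hL (fun l _ => one_quarter_le_blockVar hz1 l) fun l hl => blockVar_le hz hl
  rw [hfield, setLIntegral_norm_exp_partialField_sq z i hE, norm_sq_eq_exp_two_div hz]
  calc _ ≤ ENNReal.ofReal (Real.exp (1 + 2 * Real.exp 2) * 2 ^ i) *
        ENNReal.ofReal (C * (1 + L) / √(i + 1)) := by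
        gcongr
        · exact exp_sum_lowFreq_exp_pow_div_le two_pos.le i
        · refine (measure_mono hshift).trans ?_
          rw [← ofReal_measureReal]
          exact ENNReal.ofReal_le_ofReal hballot
    _ = _ := by rw [← ENNReal.ofReal_mul (by positivity)]; congr 1; ring

end Spine

section GoodEvent

/-- The squared Hardy norm of `exp (partialField (lowFreq j) x)` on the circle of radius
`exp (2 / 2 ^ j)`, as a sum over its Taylor coefficients. -/
noncomputable def hardyNormSq (j : ℕ) (x : ℕ+ → ℂ) : ENNReal :=
  ∑' m, ENNReal.ofReal (‖chaosCoeff (lowFreq j) x m‖ ^ 2 * Real.exp (4 / 2 ^ j) ^ m)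

/-- The event that, at every dyadic scale `j ≤ i`, the Hardy norm of the chaos exceeds its typical
size `2 ^ (j / 2)` by at most a factor `y * (j + 1)`. -/
def goodSet (y : ℝ) (i : ℕ) : Set (ℕ+ → ℂ) :=
  {x | ∀ j ≤ i, hardyNormSq j x ≤ ENNReal.ofReal (y ^ 2 * 2 ^ j * (j + 1) ^ 2)}

@[fun_prop]
theorem measurable_hardyNormSq (j : ℕ) : Measurable (hardyNormSq j) :=
  Measurable.tsum fun m => by fun_prop

theorem dependsOn_hardyNormSq (j : ℕ) : DependsOn (hardyNormSq j) (lowFreq j : Set ℕ+) :=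
  fun x x' h => by simp only [hardyNormSq, dependsOn_chaosCoeff (lowFreq j) h]

theorem measurableSet_goodSet (y : ℝ) (i : ℕ) : MeasurableSet (goodSet y i) := by
  simp only [goodSet, Set.ofPred_forall]
  exact .iInter fun j => .iInter fun _ => measurableSet_le (by fun_prop) (by fun_prop)

theorem dependsOn_mem_goodSet (y : ℝ) (i : ℕ) :
    DependsOn (· ∈ goodSet y i) (lowFreq i : Set ℕ+) := by
  intro x x' h
  simp only [goodSet, Set.mem_ofPred_eq, eq_iff_iff]
  refine forall₂_congr fun j hj => ?_
  rw [dependsOn_hardyNormSq j fun k hk => h k (lowFreq_mono hj hk)]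

theorem goodSet_anti (y : ℝ) {i j : ℕ} (h : i ≤ j) : goodSet y j ⊆ goodSet y i :=
  fun _ hx l hl => hx l (hl.trans h)

theorem lintegral_hardyNormSq_le (j : ℕ) : ∫⁻ x, hardyNormSq j x ∂gaussianSeq ≤
    ENNReal.ofReal (Real.exp (1 + 4 * Real.exp 4) * 2 ^ j) := by
  have hterm (m : ℕ) : ∫⁻ x, ENNReal.ofReal
      (‖chaosCoeff (lowFreq j) x m‖ ^ 2 * Real.exp (4 / 2 ^ j) ^ m) ∂gaussianSeq =
        ENNReal.ofReal (varCoeff (lowFreq j) m * Real.exp (4 / 2 ^ j) ^ m) := by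
    rw [← ofReal_integral_eq_lintegral_ofReal
      ((integrable_norm_chaosCoeff_sq _ m).mul_const _) (.of_forall fun x => by positivity),
      integral_mul_const, integral_norm_chaosCoeff_sq]
  have hsum := hasSum_varCoeff (lowFreq j) (Real.exp (4 / 2 ^ j))
  simp only [hardyNormSq]
  rw [lintegral_tsum fun m => by fun_prop, tsum_congr hterm, ← ENNReal.ofReal_tsum_of_nonneg
    (fun m => mul_nonneg (varCoeff_nonneg _ m) (by positivity)) hsum.summable, hsum.tsum_eq]
  exact ENNReal.ofReal_le_ofReal (exp_sum_lowFreq_exp_pow_div_le (by norm_num) j)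

theorem measureReal_hardyNormSq_ge_le (j : ℕ) {A : ℝ} (hA : 0 < A) :
    gaussianSeq.real {x | ENNReal.ofReal A ≤ hardyNormSq j x} ≤
      Real.exp (1 + 4 * Real.exp 4) * 2 ^ j / A := by
  refine ENNReal.toReal_le_of_le_ofReal (by positivity) ?_
  rw [ENNReal.ofReal_div_of_pos hA]
  exact (meas_ge_le_lintegral_div (by fun_prop) (ENNReal.ofReal_pos.2 hA).ne'
    ENNReal.ofReal_ne_top).trans (ENNReal.div_le_div_right (lintegral_hardyNormSq_le j) _)

theorem compl_goodSet_subset (y : ℝ) (i : ℕ) : (goodSet y i)ᶜ ⊆ ⋃ j ∈ Finset.range (i + 1),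
    {x | ENNReal.ofReal (y ^ 2 * 2 ^ j * (j + 1) ^ 2) ≤ hardyNormSq j x} := by
  intro x hx
  simp only [goodSet, Set.mem_compl_iff, Set.mem_ofPred_eq, not_forall, not_le] at hx
  obtain ⟨j, hj, hlt⟩ := hx
  exact Set.mem_biUnion (Finset.mem_coe.2 (Finset.mem_range_succ_iff.2 hj)) hlt.le

theorem exists_measureReal_compl_goodSet_le : ∃ C : ℝ, 0 < C ∧ ∀ {y : ℝ}, 0 < y → ∀ i : ℕ,
    gaussianSeq.real (goodSet y i)ᶜ ≤ C / y ^ 2 := by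
  set c : ℝ := Real.exp (1 + 4 * Real.exp 4)
  have hsummable : Summable fun j : ℕ => 1 / ((j : ℝ) + 1) ^ 2 := by
    simpa using (summable_nat_add_iff 1).2 (Real.summable_one_div_nat_pow.2 one_lt_two)
  have hpos : 0 < ∑' j : ℕ, 1 / ((j : ℝ) + 1) ^ 2 :=
    hsummable.tsum_pos (fun j => by positivity) 0 (by positivity)
  refine ⟨c * ∑' j : ℕ, 1 / ((j : ℝ) + 1) ^ 2, by positivity, fun {y} hy i => ?_⟩
  calc gaussianSeq.real (goodSet y i)ᶜ
      ≤ ∑ j ∈ Finset.range (i + 1), gaussianSeq.real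
          {x | ENNReal.ofReal (y ^ 2 * 2 ^ j * (j + 1) ^ 2) ≤ hardyNormSq j x} :=
        (measureReal_mono (compl_goodSet_subset y i) (measure_ne_top _ _)).trans
          (measureReal_biUnion_finset_le _ _)
    _ ≤ ∑ j ∈ Finset.range (i + 1), c * 2 ^ j / (y ^ 2 * 2 ^ j * (j + 1) ^ 2) :=
        Finset.sum_le_sum fun j _ => measureReal_hardyNormSq_ge_le j (by positivity)
    _ = c / y ^ 2 * ∑ j ∈ Finset.range (i + 1), 1 / ((j : ℝ) + 1) ^ 2 := by
        rw [Finset.mul_sum]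
        refine Finset.sum_congr rfl fun j _ => ?_
        field_simp
    _ ≤ c / y ^ 2 * ∑' j : ℕ, 1 / ((j : ℝ) + 1) ^ 2 := by
        gcongr
        exact hsummable.sum_le_tsum _ fun j _ => by positivity
    _ = c * (∑' j : ℕ, 1 / ((j : ℝ) + 1) ^ 2) / y ^ 2 := by ring

theorem norm_sq_le_of_hasSum_mul_pow {𝕜 : Type*} [RCLike 𝕜] {a : ℕ → 𝕜} {z F : 𝕜} {A R : ℝ}
    (hF : HasSum (fun m => a m * z ^ m) F)
    (ha : ∑' m, ENNReal.ofReal (‖a m‖ ^ 2 * R ^ m) ≤ ENNReal.ofReal A) (hA : 0 ≤ A)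
    (hz : ‖z‖ ^ 2 < R) : ‖F‖ ^ 2 ≤ A * (1 - ‖z‖ ^ 2 / R)⁻¹ := by
  have hR : 0 < R := (sq_nonneg _).trans_lt hz
  have hq : ‖z‖ ^ 2 / R < 1 := (div_lt_one hR).2 hz
  refine le_of_tendsto' (hF.tendsto_sum_nat.norm.pow 2) fun M => ?_
  have hcoeff : ∑ m ∈ Finset.range M, ‖a m‖ ^ 2 * R ^ m ≤ A := by
    rw [← ENNReal.ofReal_le_ofReal_iff hA, ENNReal.ofReal_sum_of_nonneg fun m _ => by positivity]
    exact (ENNReal.sum_le_tsum _).trans ha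
  have hgeom : ∑ m ∈ Finset.range M, (‖z‖ ^ 2 / R) ^ m ≤ (1 - ‖z‖ ^ 2 / R)⁻¹ := by
    rw [← tsum_geometric_of_lt_one (by positivity) hq]
    exact (summable_geometric_of_lt_one (by positivity) hq).sum_le_tsum _ fun m _ => by positivity
  calc ‖∑ m ∈ Finset.range M, a m * z ^ m‖ ^ 2
      ≤ (∑ m ∈ Finset.range M, ‖a m * z ^ m‖) ^ 2 := by gcongr; exact norm_sum_le _ _
    _ ≤ (∑ m ∈ Finset.range M, ‖a m‖ ^ 2 * R ^ m) * ∑ m ∈ Finset.range M, (‖z‖ ^ 2 / R) ^ m := by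
        refine Finset.sum_sq_le_sum_mul_sum_of_sq_le_mul _ (fun m _ => by positivity)
          (fun m _ => by positivity) fun m _ => le_of_eq ?_
        rw [norm_mul, norm_pow, mul_assoc, ← mul_pow, mul_div_cancel₀ _ hR.ne']
        ring
    _ ≤ A * (1 - ‖z‖ ^ 2 / R)⁻¹ := by gcongr

theorem inv_one_sub_exp_neg_le {u : ℝ} (hu : 0 < u) : (1 - Real.exp (-u))⁻¹ ≤ 1 + 1 / u := by
  have hexp : Real.exp (-u) ≤ (u + 1)⁻¹ := by
    rw [Real.exp_neg]
    exact inv_anti₀ (by positivity) (Real.add_one_le_exp u)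
  have hsub : u / (u + 1) ≤ 1 - Real.exp (-u) := by
    calc u / (u + 1) = 1 - (u + 1)⁻¹ := by field_simp; ring
      _ ≤ 1 - Real.exp (-u) := by gcongr
  calc (1 - Real.exp (-u))⁻¹ ≤ (u / (u + 1))⁻¹ := inv_anti₀ (by positivity) hsub
    _ = 1 + 1 / u := by rw [inv_div, add_div, div_self hu.ne']

theorem norm_exp_partialField_sq_le {y : ℝ} {j : ℕ} {x : ℕ+ → ℂ}
    (hx : hardyNormSq j x ≤ ENNReal.ofReal (y ^ 2 * 2 ^ j * (j + 1) ^ 2)) {z : ℂ}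
    (hz : ‖z‖ ≤ Real.exp (1 / 2 ^ j)) :
    ‖Complex.exp (partialField (lowFreq j) x z)‖ ^ 2 ≤ 2 * (y * 2 ^ j * (j + 1)) ^ 2 := by
  have hz2 : ‖z‖ ^ 2 ≤ Real.exp (2 / 2 ^ j) := by
    calc ‖z‖ ^ 2 ≤ Real.exp (1 / 2 ^ j) ^ 2 := by gcongr
      _ = Real.exp (2 / 2 ^ j) := by rw [← Real.exp_nat_mul]; congr 1; push_cast; ring
  have hlt : Real.exp (2 / 2 ^ j) < Real.exp (4 / 2 ^ j) := by gcongr; norm_num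
  have hratio : ‖z‖ ^ 2 / Real.exp (4 / 2 ^ j) ≤ Real.exp (-(2 / 2 ^ j)) := by
    rw [div_le_iff₀ (Real.exp_pos _), ← Real.exp_add]
    exact hz2.trans_eq (by congr 1; ring)
  have hgap : Real.exp (-(2 / 2 ^ j)) < 1 := Real.exp_lt_one_iff.2 (neg_neg_of_pos (by positivity))
  calc ‖Complex.exp (partialField (lowFreq j) x z)‖ ^ 2
      ≤ y ^ 2 * 2 ^ j * (j + 1) ^ 2 * (1 - ‖z‖ ^ 2 / Real.exp (4 / 2 ^ j))⁻¹ :=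
        norm_sq_le_of_hasSum_mul_pow (hasSum_chaosCoeff_mul_pow _ _ _) hx (by positivity)
          (hz2.trans_lt hlt)
    _ ≤ y ^ 2 * 2 ^ j * (j + 1) ^ 2 * (1 - Real.exp (-(2 / 2 ^ j)))⁻¹ := by
        gcongr
    _ ≤ y ^ 2 * 2 ^ j * (j + 1) ^ 2 * (2 * 2 ^ j) := by
        gcongr
        refine (inv_one_sub_exp_neg_le (by positivity)).trans ?_
        rw [one_div_div]
        linarith [one_le_pow₀ (n := j) (one_le_two (α := ℝ))]
    _ = 2 * (y * 2 ^ j * (j + 1)) ^ 2 := by ring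

theorem goodSet_subset_fieldBelow {y : ℝ} (hy : 0 < y) {i : ℕ} {z : ℂ}
    (hz : ‖z‖ = Real.exp (1 / 2 ^ i)) : goodSet y i ⊆ fieldBelow (Real.log y + 1) i z := by
  intro x hx j hj
  have hzj : ‖z‖ ≤ Real.exp (1 / 2 ^ j) := by
    rw [hz]
    gcongr
    exact one_le_two
  have hbound : Real.exp (partialField (lowFreq j) x z).re ≤
      Real.exp 1 * (y * 2 ^ j * (j + 1)) := by
    have hexp : 2 ≤ Real.exp 1 ^ 2 := by nlinarith [Real.add_one_le_exp (1 : ℝ)]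
    rw [← Complex.norm_exp, ← pow_le_pow_iff_left₀ (norm_nonneg _) (by positivity) two_ne_zero,
      mul_pow (Real.exp 1)]
    refine (norm_exp_partialField_sq_le (hx j hj) hzj).trans ?_
    gcongr
  calc (partialField (lowFreq j) x z).re
      ≤ Real.log (Real.exp 1 * (y * 2 ^ j * (j + 1))) :=
        (Real.le_log_iff_exp_le (by positivity)).2 hbound
    _ = Real.log y + 1 + j * Real.log 2 + Real.log (j + 1) := by
        rw [Real.log_mul (by positivity) (by positivity), Real.log_exp,
          Real.log_mul (by positivity) (by positivity), Real.log_mul hy.ne' (by positivity),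
          Real.log_pow]
        ring

end GoodEvent

section Increment

open Finset.HasAntidiagonal (antidiagonal mem_antidiagonal)

theorem ofReal_sum_norm_chaosCoeff_sq_le_lintegral (s : Finset ℕ+) (x : ℕ+ → ℂ) {r : ℝ}
    (hr : 0 ≤ r) (S : Finset ℕ) :
    ENNReal.ofReal (2 * Real.pi * ∑ l ∈ S, r ^ (2 * l) * ‖chaosCoeff s x l‖ ^ 2) ≤
      ∫⁻ t in Set.Ioc 0 (2 * Real.pi),
        ENNReal.ofReal (‖Complex.exp (partialField s x (circleMap 0 r t))‖ ^ 2) := by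
  have hcont : Continuous fun t => Complex.exp (partialField s x (circleMap 0 r t)) := by fun_prop
  have hparseval := hasSum_norm_sq_mul_pow_circleMap hr (summable_norm_chaosCoeff_mul_pow s x hr)
    (fun t => hasSum_chaosCoeff_mul_pow s x (circleMap 0 r t)) hcont
  rw [← ofReal_integral_eq_lintegral_ofReal (by fun_prop : Continuous fun t =>
      ‖Complex.exp (partialField s x (circleMap 0 r t))‖ ^ 2).integrableOn_Ioc
    (.of_forall fun t => sq_nonneg _), ← intervalIntegral.integral_of_le (by positivity)]
  refine ENNReal.ofReal_le_ofReal (le_of_eq_of_le ?_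
    (sum_le_hasSum S (fun m _ => by positivity) hparseval))
  simp only [Finset.mul_sum, mul_comm]

theorem measurable_partialField_circleMap (s : Finset ℕ+) (r : ℝ) :
    Measurable fun p : (ℕ+ → ℂ) × ℝ => partialField s p.1 (circleMap 0 r p.2) := by
  have := (continuous_circleMap 0 r).measurable
  unfold partialField
  fun_prop

theorem sum_pow_mul_setIntegral_norm_chaosCoeff_sq_le (s : Finset ℕ+) {r B : ℝ} (hr : 0 ≤ r)
    (hB : 0 ≤ B) {E : Set (ℕ+ → ℂ)} (hE : ∀ z, ‖z‖ = r → ∫⁻ x in E,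
      ENNReal.ofReal (‖Complex.exp (partialField s x z)‖ ^ 2) ∂gaussianSeq ≤ ENNReal.ofReal B)
    (S : Finset ℕ) :
    ∑ l ∈ S, r ^ (2 * l) * ∫ x in E, ‖chaosCoeff s x l‖ ^ 2 ∂gaussianSeq ≤ B := by
  have hinteg (l : ℕ) : Integrable (fun x => r ^ (2 * l) * ‖chaosCoeff s x l‖ ^ 2)
      (gaussianSeq.restrict E) :=
    (integrable_norm_chaosCoeff_sq s l).integrableOn.const_mul _
  have hmeas := measurable_partialField_circleMap s r
  simp only [← integral_const_mul]
  rw [← integral_finsetSum _ fun l _ => hinteg l]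
  refine le_of_mul_le_mul_left ?_ Real.two_pi_pos
  rw [← ENNReal.ofReal_le_ofReal_iff (by positivity)]
  calc ENNReal.ofReal (2 * Real.pi *
        ∫ x in E, ∑ l ∈ S, r ^ (2 * l) * ‖chaosCoeff s x l‖ ^ 2 ∂gaussianSeq)
      = ∫⁻ x in E, ENNReal.ofReal
          (2 * Real.pi * ∑ l ∈ S, r ^ (2 * l) * ‖chaosCoeff s x l‖ ^ 2) ∂gaussianSeq := by
        rw [← integral_const_mul, ofReal_integral_eq_lintegral_ofReal
          ((integrable_finsetSum _ fun l _ => hinteg l).const_mul _)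
          (.of_forall fun x => by positivity)]
    _ ≤ ∫⁻ x in E, (∫⁻ t in Set.Ioc 0 (2 * Real.pi), ENNReal.ofReal
          (‖Complex.exp (partialField s x (circleMap 0 r t))‖ ^ 2)) ∂gaussianSeq :=
        lintegral_mono fun x => ofReal_sum_norm_chaosCoeff_sq_le_lintegral s x hr S
    _ = ∫⁻ t in Set.Ioc 0 (2 * Real.pi), ∫⁻ x in E, ENNReal.ofReal
          (‖Complex.exp (partialField s x (circleMap 0 r t))‖ ^ 2) ∂gaussianSeq :=
        lintegral_lintegral_swap (hmeas.cexp.norm.pow_const 2).ennreal_ofReal.aemeasurable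
    _ ≤ ∫⁻ _ in Set.Ioc 0 (2 * Real.pi), ENNReal.ofReal B :=
        lintegral_mono fun t => hE _ (by simp [abs_of_nonneg hr])
    _ = ENNReal.ofReal (2 * Real.pi * B) := by
        rw [setLIntegral_const, Real.volume_Ioc, sub_zero, mul_comm,
          ← ENNReal.ofReal_mul (by positivity)]

theorem exists_sum_exp_pow_mul_setIntegral_goodSet_le :
    ∃ C : ℝ, 0 < C ∧ ∀ (i : ℕ) {y : ℝ}, 1 ≤ y → ∀ S : Finset ℕ,
      ∑ l ∈ S, Real.exp (2 / 2 ^ i) ^ l *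
        ∫ x in goodSet y i, ‖chaosCoeff (lowFreq i) x l‖ ^ 2 ∂gaussianSeq ≤
        C * 2 ^ i * ((2 + Real.log y) / √(i + 1)) := by
  obtain ⟨C, hC0, hC⟩ := exists_setLIntegral_fieldBelow_norm_exp_sq_le
  refine ⟨C, hC0, fun i {y} hy S => ?_⟩
  have hlog : 0 ≤ Real.log y := Real.log_nonneg hy
  have hradius (l : ℕ) : Real.exp (2 / 2 ^ i) ^ l = Real.exp (1 / 2 ^ i) ^ (2 * l) := by
    rw [pow_mul, ← Real.exp_nat_mul _ 2]
    congr 2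
    ring
  simp only [hradius]
  refine sum_pow_mul_setIntegral_norm_chaosCoeff_sq_le _ (by positivity) (by positivity)
    (fun z hz => ?_) S
  refine (lintegral_mono_set (goodSet_subset_fieldBelow (by linarith) hz)).trans
    ((hC i z hz (by linarith)).trans_eq ?_)
  congr 3
  ring

theorem varCoeff_blockFreq_mul_exp_pow_le (i : ℕ) {m : ℕ} (hm : m ≠ 0) :
    varCoeff (blockFreq i) m * Real.exp (2 / 2 ^ i) ^ m ≤
      Real.exp 4 * Real.exp (Real.exp 4) / 2 ^ i := by
  have hscale : Real.exp (2 / 2 ^ i) = Real.exp (4 / 2 ^ (i + 1)) := by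
    congr 1
    field_simp
    ring
  have hbound (k : ℕ+) (hk : k ∈ blockFreq i) :
      Real.exp (2 / 2 ^ i) ^ (k : ℕ) ≤ Real.exp 4 := by
    rw [hscale]
    exact exp_div_two_pow_pow_le (by norm_num) (mem_blockFreq.1 hk).2.le
  exact_mod_cast varCoeff_mul_pow_le (by positivity) (fun k hk => (mem_blockFreq.1 hk).1)
    (sum_blockFreq_inv_le_one i) (by positivity) hbound (by positivity) hm

theorem sum_antidiagonal_mul_le {v w : ℕ → ℝ} {x B : ℝ} (hx : 0 < x) (hw : ∀ l, 0 ≤ w l)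
    (hB : 0 ≤ B) (hv : ∀ m, m ≠ 0 → v m * x ^ m ≤ B) (n : ℕ) :
    ∑ p ∈ (antidiagonal n).filter fun p => p.2 ≠ 0, v p.2 * w p.1 ≤
      B * (x ^ n)⁻¹ * ∑ l ∈ Finset.range (n + 1), x ^ l * w l := by
  calc ∑ p ∈ (antidiagonal n).filter fun p => p.2 ≠ 0, v p.2 * w p.1
      ≤ ∑ p ∈ (antidiagonal n).filter fun p => p.2 ≠ 0, B * (x ^ n)⁻¹ * (x ^ p.1 * w p.1) := by
        refine Finset.sum_le_sum fun p hp => ?_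
        obtain ⟨hpn, hp2⟩ := Finset.mem_filter.1 hp
        refine (mul_le_mul_of_nonneg_right ((le_div_iff₀ (by positivity)).2 (hv p.2 hp2))
          (hw p.1)).trans_eq ?_
        rw [← mem_antidiagonal.1 hpn, pow_add]
        field_simp
    _ ≤ ∑ p ∈ antidiagonal n, B * (x ^ n)⁻¹ * (x ^ p.1 * w p.1) :=
        Finset.sum_le_sum_of_subset_of_nonneg (Finset.filter_subset _ _) fun p _ _ => by
          have := hw p.1
          positivity
    _ = B * (x ^ n)⁻¹ * ∑ l ∈ Finset.range (n + 1), x ^ l * w l := by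
        rw [Finset.Nat.sum_antidiagonal_eq_sum_range_succ
          (fun l _ => B * (x ^ n)⁻¹ * (x ^ l * w l)) n, Finset.mul_sum]

theorem exists_setIntegral_norm_chaosCoeff_sub_sq_le :
    ∃ C : ℝ, 0 < C ∧ ∀ (i : ℕ) {y : ℝ}, 1 ≤ y → ∀ n : ℕ,
      ∫ x in goodSet y i,
        ‖chaosCoeff (lowFreq (i + 1)) x n - chaosCoeff (lowFreq i) x n‖ ^ 2 ∂gaussianSeq ≤
        C * Real.exp (-(2 * n / 2 ^ i)) * ((2 + Real.log y) / √(i + 1)) := by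
  obtain ⟨C, hC0, hC⟩ := exists_sum_exp_pow_mul_setIntegral_goodSet_le
  set B : ℝ := Real.exp 4 * Real.exp (Real.exp 4)
  refine ⟨B * C, by positivity, fun i {y} hy n => ?_⟩
  have hexp : (Real.exp (2 / 2 ^ i) ^ n)⁻¹ = Real.exp (-(2 * n / 2 ^ i)) := by
    rw [Real.exp_neg, ← Real.exp_nat_mul]
    congr 2
    ring
  rw [lowFreq_succ, setIntegral_norm_chaosCoeff_sub_sq (disjoint_lowFreq_blockFreq i)
    (measurableSet_goodSet y i) (dependsOn_mem_goodSet y i), ← hexp]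
  calc _ ≤ B / 2 ^ i * (Real.exp (2 / 2 ^ i) ^ n)⁻¹ * ∑ l ∈ Finset.range (n + 1),
        Real.exp (2 / 2 ^ i) ^ l *
          ∫ x in goodSet y i, ‖chaosCoeff (lowFreq i) x l‖ ^ 2 ∂gaussianSeq :=
        sum_antidiagonal_mul_le (by positivity) (fun l => integral_nonneg fun x => sq_nonneg _)
          (by positivity) (fun m hm => varCoeff_blockFreq_mul_exp_pow_le i hm) n
    _ ≤ B / 2 ^ i * (Real.exp (2 / 2 ^ i) ^ n)⁻¹ *
        (C * 2 ^ i * ((2 + Real.log y) / √(i + 1))) := by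
        gcongr
        exact hC i hy _
    _ = B * C * (Real.exp (2 / 2 ^ i) ^ n)⁻¹ * ((2 + Real.log y) / √(i + 1)) := by field_simp

end Increment

section Tail

theorem norm_sum_range_sq_le_sum_two_pow {E : Type*} [SeminormedAddCommGroup E] (d : ℕ → E)
    (I : ℕ) : ‖∑ m ∈ Finset.range I, d m‖ ^ 2 ≤
      2 * ∑ m ∈ Finset.range I, 2 ^ m * ‖d m‖ ^ 2 := by
  calc ‖∑ m ∈ Finset.range I, d m‖ ^ 2 ≤ (∑ m ∈ Finset.range I, ‖d m‖) ^ 2 := by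
        gcongr
        exact norm_sum_le _ _
    _ ≤ (∑ m ∈ Finset.range I, (1 / 2 : ℝ) ^ m) * ∑ m ∈ Finset.range I, 2 ^ m * ‖d m‖ ^ 2 :=
        Finset.sum_sq_le_sum_mul_sum_of_sq_le_mul _ (fun m _ => by positivity)
          (fun m _ => by positivity) fun m _ => by
            rw [← mul_assoc, ← mul_pow, one_div_mul_cancel two_ne_zero, one_pow, one_mul]
    _ ≤ 2 * ∑ m ∈ Finset.range I, 2 ^ m * ‖d m‖ ^ 2 := by
        gcongr
        exact sum_geometric_two_le I

theorem two_pow_mul_sqrt_mul_exp_neg_le (m : ℕ) :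
    (2 : ℝ) ^ m * √(m + 1) * Real.exp (-(2 * 2 ^ m)) ≤ (1 / 2) ^ m := by
  have hsucc : (m : ℝ) + 1 ≤ 2 ^ m := by exact_mod_cast (Nat.lt_two_pow_self : m < 2 ^ m)
  have hsqrt : √((m : ℝ) + 1) ≤ 2 ^ m := by
    rw [Real.sqrt_le_left (by positivity)]
    exact hsucc.trans (le_self_pow₀ (one_le_pow₀ one_le_two) two_ne_zero)
  have hcube : ((2 : ℝ) ^ m) ^ 3 ≤ Real.exp (2 * 2 ^ m) := by
    calc ((2 : ℝ) ^ m) ^ 3 ≤ (2 * 2 ^ m) ^ 3 / (Nat.factorial 3 : ℕ) := by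
          rw [mul_pow, le_div_iff₀ (by positivity), mul_comm]
          gcongr
          norm_num [Nat.factorial]
      _ ≤ Real.exp (2 * 2 ^ m) := Real.pow_div_factorial_le_exp _ (by positivity) 3
  rw [Real.exp_neg, ← div_eq_mul_inv, div_le_iff₀ (Real.exp_pos _)]
  calc (2 : ℝ) ^ m * √((m : ℝ) + 1) ≤ 2 ^ m * 2 ^ m := by gcongr
    _ = (1 / 2) ^ m * (2 ^ m) ^ 3 := by
        rw [one_div, inv_pow]
        field_simp
    _ ≤ (1 / 2) ^ m * Real.exp (2 * 2 ^ m) := by gcongr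

theorem one_div_sqrt_sub_le {J m : ℕ} (hm : m ≤ J) :
    1 / √(((J - m : ℕ) : ℝ) + 1) ≤ √(m + 1) / √(J + 1) := by
  obtain ⟨k, rfl⟩ := Nat.exists_eq_add_of_le hm
  rw [div_le_div_iff₀ (by positivity) (by positivity), one_mul, ← Real.sqrt_mul (by positivity),
    Nat.add_sub_cancel_left]
  gcongr
  push_cast
  nlinarith [mul_nonneg (m.cast_nonneg (α := ℝ)) (k.cast_nonneg (α := ℝ))]

theorem norm_chaosCoeff_sq_le_sum_increments (x : ℕ+ → ℂ) {n : ℕ} (hn : n ≠ 0) (J : ℕ) :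
    ‖chaosCoeff (lowFreq (J + 1)) x n‖ ^ 2 ≤ 2 * ∑ m ∈ Finset.range (J + 1), 2 ^ m *
      ‖chaosCoeff (lowFreq (J - m + 1)) x n - chaosCoeff (lowFreq (J - m)) x n‖ ^ 2 := by
  have hzero : chaosCoeff (lowFreq 0) x n = 0 :=
    coeff_expPoly_eq_zero _ hn (by simp [lowFreq_zero])
  have htelescope : chaosCoeff (lowFreq (J + 1)) x n = ∑ m ∈ Finset.range (J + 1),
      (chaosCoeff (lowFreq (J - m + 1)) x n - chaosCoeff (lowFreq (J - m)) x n) := by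
    rw [← Finset.sum_range_reflect, ← sub_zero (chaosCoeff (lowFreq (J + 1)) x n), ← hzero,
      ← Finset.sum_range_sub fun i => chaosCoeff (lowFreq i) x n]
    refine Finset.sum_congr rfl fun i hi => ?_
    rw [Nat.add_sub_cancel, Nat.sub_sub_self (Finset.mem_range_succ_iff.1 hi)]
  rw [htelescope]
  exact norm_sum_range_sq_le_sum_two_pow _ _

theorem integrable_norm_chaosCoeff_sub_sq (s t : Finset ℕ+) (n : ℕ) :
    Integrable (fun x => ‖chaosCoeff s x n - chaosCoeff t x n‖ ^ 2) gaussianSeq :=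
  have hmem := (memLp_chaosCoeff s n).sub (memLp_chaosCoeff t n)
  (memLp_two_iff_integrable_sq_norm hmem.1).1 hmem

theorem exists_two_pow_mul_setIntegral_increment_le :
    ∃ C : ℝ, 0 < C ∧ ∀ {y : ℝ}, 1 ≤ y → ∀ {n J m : ℕ}, 2 ^ J ≤ n → m ≤ J →
      2 ^ m * ∫ x in goodSet y J, ‖chaosCoeff (lowFreq (J - m + 1)) x n -
        chaosCoeff (lowFreq (J - m)) x n‖ ^ 2 ∂gaussianSeq ≤
        C * ((2 + Real.log y) / √(J + 1)) * (1 / 2) ^ m := by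
  obtain ⟨C, hC0, hC⟩ := exists_setIntegral_norm_chaosCoeff_sub_sq_le
  refine ⟨C, hC0, fun {y} hy {n J m} hn hm => ?_⟩
  have hlog : 0 ≤ Real.log y := Real.log_nonneg hy
  have hdecay : Real.exp (-(2 * n / 2 ^ (J - m))) ≤ Real.exp (-(2 * 2 ^ m)) := by
    gcongr
    rw [le_div_iff₀ (by positivity), mul_assoc, ← pow_add, Nat.add_sub_cancel' hm]
    gcongr
    exact_mod_cast hn
  calc 2 ^ m * ∫ x in goodSet y J, ‖chaosCoeff (lowFreq (J - m + 1)) x n -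
        chaosCoeff (lowFreq (J - m)) x n‖ ^ 2 ∂gaussianSeq
      ≤ 2 ^ m * ∫ x in goodSet y (J - m), ‖chaosCoeff (lowFreq (J - m + 1)) x n -
        chaosCoeff (lowFreq (J - m)) x n‖ ^ 2 ∂gaussianSeq := by
        refine mul_le_mul_of_nonneg_left ?_ (by positivity)
        exact setIntegral_mono_set (integrable_norm_chaosCoeff_sub_sq _ _ n).integrableOn
          (.of_forall fun x => sq_nonneg _) (goodSet_anti y (Nat.sub_le J m)).eventuallyLE
    _ ≤ 2 ^ m * (C * Real.exp (-(2 * n / 2 ^ (J - m))) *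
          ((2 + Real.log y) / √(((J - m : ℕ) : ℝ) + 1))) := by
        gcongr
        exact hC (J - m) hy n
    _ ≤ 2 ^ m * (C * Real.exp (-(2 * 2 ^ m)) * ((2 + Real.log y) * (√(m + 1) / √(J + 1)))) := by
        rw [div_eq_mul_one_div (2 + Real.log y)]
        gcongr 2 ^ m * (C * ?_ * (_ * ?_))
        exact one_div_sqrt_sub_le hm
    _ = C * ((2 + Real.log y) / √(J + 1)) * (2 ^ m * √(m + 1) * Real.exp (-(2 * 2 ^ m))) := by
        ring
    _ ≤ C * ((2 + Real.log y) / √(J + 1)) * (1 / 2) ^ m := by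
        gcongr
        exact two_pow_mul_sqrt_mul_exp_neg_le m

theorem exists_setIntegral_norm_chaosCoeff_sq_le :
    ∃ C : ℝ, 0 < C ∧ ∀ {y : ℝ}, 1 ≤ y → ∀ {n J : ℕ}, 2 ^ J ≤ n →
      ∫ x in goodSet y J, ‖chaosCoeff (lowFreq (J + 1)) x n‖ ^ 2 ∂gaussianSeq ≤
        C * ((2 + Real.log y) / √(J + 1)) := by
  obtain ⟨C, hC0, hC⟩ := exists_two_pow_mul_setIntegral_increment_le
  refine ⟨4 * C, by positivity, fun {y} hy {n J} hn => ?_⟩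
  have hlog : 0 ≤ Real.log y := Real.log_nonneg hy
  have hn0 : n ≠ 0 := ((Nat.two_pow_pos J).trans_le hn).ne'
  have hinteg (m : ℕ) : Integrable (fun x => 2 ^ m * ‖chaosCoeff (lowFreq (J - m + 1)) x n -
      chaosCoeff (lowFreq (J - m)) x n‖ ^ 2) (gaussianSeq.restrict (goodSet y J)) :=
    (integrable_norm_chaosCoeff_sub_sq _ _ n).integrableOn.const_mul _
  calc ∫ x in goodSet y J, ‖chaosCoeff (lowFreq (J + 1)) x n‖ ^ 2 ∂gaussianSeq
      ≤ ∫ x in goodSet y J, 2 * ∑ m ∈ Finset.range (J + 1), 2 ^ m *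
          ‖chaosCoeff (lowFreq (J - m + 1)) x n - chaosCoeff (lowFreq (J - m)) x n‖ ^ 2
          ∂gaussianSeq :=
        integral_mono (integrable_norm_chaosCoeff_sq _ n).integrableOn
          ((integrable_finsetSum _ fun m _ => hinteg m).const_mul _)
          fun x => norm_chaosCoeff_sq_le_sum_increments x hn0 J
    _ = 2 * ∑ m ∈ Finset.range (J + 1), 2 ^ m * ∫ x in goodSet y J,
          ‖chaosCoeff (lowFreq (J - m + 1)) x n - chaosCoeff (lowFreq (J - m)) x n‖ ^ 2
          ∂gaussianSeq := by
        rw [integral_const_mul, integral_finsetSum _ fun m _ => hinteg m]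
        simp only [integral_const_mul]
    _ ≤ 2 * ∑ m ∈ Finset.range (J + 1), C * ((2 + Real.log y) / √(J + 1)) * (1 / 2) ^ m := by
        refine mul_le_mul_of_nonneg_left (Finset.sum_le_sum fun m hm => ?_) two_pos.le
        exact hC hy hn (Finset.mem_range_succ_iff.1 hm)
    _ ≤ 2 * (C * ((2 + Real.log y) / √(J + 1)) * 2) := by
        rw [← Finset.mul_sum]
        gcongr
        exact sum_geometric_two_le _
    _ = 4 * C * ((2 + Real.log y) / √(J + 1)) := by ring

theorem measureReal_rpow_mul_norm_ge_le {Ω E : Type*} {mΩ : MeasurableSpace Ω}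
    [NormedAddCommGroup E] {μ : Measure Ω} [IsFiniteMeasure μ] {X : Ω → E}
    (hX : Integrable (fun ω => ‖X ω‖ ^ 2) μ) {a y : ℝ} (ha : 0 ≤ a) (hy : 0 < y) :
    μ.real {ω | y ≤ a ^ (1 / 4 : ℝ) * ‖X ω‖} ≤ √a * (∫ ω, ‖X ω‖ ^ 2 ∂μ) / y ^ 2 := by
  have hroot : (a ^ (1 / 4 : ℝ)) ^ 2 = √a := by
    rw [Real.sqrt_eq_rpow, ← Real.rpow_natCast, ← Real.rpow_mul ha]
    norm_num
  have hsub : {ω | y ≤ a ^ (1 / 4 : ℝ) * ‖X ω‖} ⊆ {ω | y ^ 2 ≤ √a * ‖X ω‖ ^ 2} := by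
    intro ω hω
    rw [Set.mem_ofPred_eq, ← hroot, ← mul_pow]
    exact pow_le_pow_left₀ hy.le hω 2
  rw [le_div_iff₀ (by positivity), mul_comm, ← integral_const_mul]
  calc y ^ 2 * μ.real {ω | y ≤ a ^ (1 / 4 : ℝ) * ‖X ω‖}
      ≤ y ^ 2 * μ.real {ω | y ^ 2 ≤ √a * ‖X ω‖ ^ 2} :=
        mul_le_mul_of_nonneg_left (measureReal_mono hsub (measure_ne_top _ _)) (sq_nonneg y)
    _ ≤ ∫ ω, √a * ‖X ω‖ ^ 2 ∂μ :=
        mul_meas_ge_le_integral_of_nonneg (.of_forall fun ω => by positivity)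
          (hX.const_mul _) (y ^ 2)

theorem measureReal_norm_chaosCoeff_ge_le_sqrt (s : Finset ℕ+) (n : ℕ) {a y : ℝ} (ha : 0 ≤ a)
    (hy : 0 < y) :
    gaussianSeq.real {x | y ≤ a ^ (1 / 4 : ℝ) * ‖chaosCoeff s x n‖} ≤ √a / y ^ 2 := by
  refine (measureReal_rpow_mul_norm_ge_le (integrable_norm_chaosCoeff_sq s n) ha hy).trans ?_
  rw [integral_norm_chaosCoeff_sq]
  gcongr
  exact mul_le_of_le_one_right (by positivity) (varCoeff_le_one s n)

theorem sqrt_log_le_sqrt_succ {n J : ℕ} (hn : n < 2 ^ (J + 1)) : √(Real.log n) ≤ √(J + 1) := by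
  gcongr
  rcases n.eq_zero_or_pos with rfl | hn0
  · simp only [CharP.cast_eq_zero, Real.log_zero]
    positivity
  calc Real.log n ≤ Real.log (2 ^ (J + 1)) := by
        gcongr
        exact_mod_cast hn.le
    _ = (J + 1) * Real.log 2 := by
        rw [Real.log_pow]
        push_cast
        rfl
    _ ≤ J + 1 := mul_le_of_le_one_right (by positivity) (by linarith [Real.log_two_lt_d9])

theorem exists_measureReal_norm_chaosCoeff_ge_le_log :
    ∃ C : ℝ, 0 < C ∧ ∀ {y : ℝ}, 2 ≤ y → ∀ {n J : ℕ}, 2 ^ J ≤ n → n < 2 ^ (J + 1) →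
      gaussianSeq.real
        {x | y ≤ Real.log n ^ (1 / 4 : ℝ) * ‖chaosCoeff (lowFreq (J + 1)) x n‖} ≤
        C * (Real.log y / y ^ 2) := by
  obtain ⟨C₁, hC₁0, hC₁⟩ := exists_measureReal_compl_goodSet_le
  obtain ⟨C₂, hC₂0, hC₂⟩ := exists_setIntegral_norm_chaosCoeff_sq_le
  refine ⟨5 * C₂ + 2 * C₁, by positivity, fun {y} hy {n J} hn hn' => ?_⟩
  have hlog : 1 ≤ 2 * Real.log y := by
    linarith [Real.log_le_log two_pos hy, Real.log_two_gt_d9]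
  set E := {x | y ≤ Real.log n ^ (1 / 4 : ℝ) * ‖chaosCoeff (lowFreq (J + 1)) x n‖}
  have hgood : gaussianSeq.real (E ∩ goodSet y J) ≤ C₂ * (2 + Real.log y) / y ^ 2 := by
    rw [← measureReal_restrict_apply' (measurableSet_goodSet y J)]
    refine (measureReal_rpow_mul_norm_ge_le (integrable_norm_chaosCoeff_sq _ n).integrableOn
      (Real.log_natCast_nonneg n) (by linarith)).trans ?_
    refine div_le_div_of_nonneg_right ?_ (sq_nonneg y)
    calc _ ≤ √((J : ℝ) + 1) * (C₂ * ((2 + Real.log y) / √(J + 1))) :=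
          mul_le_mul (sqrt_log_le_sqrt_succ hn') (hC₂ (by linarith) hn)
            (integral_nonneg fun x => sq_nonneg _) (Real.sqrt_nonneg _)
      _ = C₂ * (2 + Real.log y) := by field_simp
  calc gaussianSeq.real E
      ≤ gaussianSeq.real (E ∩ goodSet y J) + gaussianSeq.real (goodSet y J)ᶜ := by
        refine (measureReal_mono fun x hx => ?_).trans (measureReal_union_le _ _)
        exact (em (x ∈ goodSet y J)).imp (fun h => ⟨hx, h⟩) id
    _ ≤ C₂ * (2 + Real.log y) / y ^ 2 + C₁ / y ^ 2 :=
        add_le_add hgood (hC₁ (by linarith) J)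
    _ = (C₂ * (2 + Real.log y) + C₁) / y ^ 2 := by ring
    _ ≤ (5 * C₂ + 2 * C₁) * Real.log y / y ^ 2 := by
        gcongr
        nlinarith
    _ = (5 * C₂ + 2 * C₁) * (Real.log y / y ^ 2) := by ring

theorem exists_measureReal_norm_chaosCoeff_ge_le :
    ∃ C : ℝ, 0 < C ∧ ∀ {y : ℝ}, 2 ≤ y → ∀ {n J : ℕ}, 2 ^ J ≤ n → n < 2 ^ (J + 1) →
      gaussianSeq.real
        {x | y ≤ Real.log n ^ (1 / 4 : ℝ) * ‖chaosCoeff (lowFreq (J + 1)) x n‖} ≤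
        C * (min √(Real.log n) (Real.log y) / y ^ 2) := by
  obtain ⟨C, hC0, hC⟩ := exists_measureReal_norm_chaosCoeff_ge_le_log
  refine ⟨1 + C, by positivity, fun {y} hy {n J} hn hn' => ?_⟩
  have hlog : 0 ≤ Real.log y := Real.log_nonneg (by linarith)
  rw [← min_div_div_right (by positivity), mul_min_of_nonneg _ _ (by positivity), le_min_iff]
  constructor
  · refine (measureReal_norm_chaosCoeff_ge_le_sqrt (lowFreq (J + 1)) n
      (Real.log_natCast_nonneg n) (by linarith)).trans ?_
    exact le_mul_of_one_le_left (by positivity) (by linarith)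
  · refine (hC hy hn hn').trans ?_
    gcongr
    linarith

theorem map_eq_gaussianSeq {Ω : Type*} {mΩ : MeasurableSpace Ω} {μ : Measure Ω} {N : ℕ+ → Ω → ℂ}
    (hG : ∀ k, IsStdComplexGaussian (N k) μ) (hI : iIndepFun N μ) :
    μ.map (fun ω k => N k ω) = gaussianSeq := by
  rw [hI.map_fun_eq_infinitePi_map₀' fun k => (hG k).gaussian.aemeasurable]
  simp only [(hG _).map_eq_stdComplexGaussian, gaussianSeq]

end Tail

theorem mainTheorem8 :
    ∃ C : ℝ, ∀ (Ω : Type*) [MeasurableSpace Ω] (μ : Measure Ω) [IsProbabilityMeasure μ]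
      (N : ℕ+ → Ω → ℂ), (∀ k, IsStdComplexGaussian (N k) μ) → iIndepFun N μ →
      ∀ (n : ℕ), 1 ≤ n → ∀ (y : ℝ), 2 ≤ y →
        μ.real {ω | y ≤ (Real.log n) ^ (1 / 4 : ℝ) * ‖hmcCoeff 1 (fun k => N k ω) n‖} ≤
          C * (min (Real.sqrt (Real.log n)) (Real.log y) / y ^ 2) := by
  obtain ⟨C, -, hC⟩ := exists_measureReal_norm_chaosCoeff_ge_le
  refine ⟨C, fun Ω _ μ _ N hG hI n hn y hy => ?_⟩
  have hlaw := map_eq_gaussianSeq hG hI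
  have hmeas : AEMeasurable (fun ω k => N k ω) μ :=
    aemeasurable_pi_iff.2 fun k => (hG k).gaussian.aemeasurable
  have hlt : n < 2 ^ (Nat.log 2 n + 1) := Nat.lt_pow_succ_log_self one_lt_two n
  refine le_trans ?_ (hC hy (Nat.pow_log_le_self 2 (by lia)) hlt)
  rw [← hlaw, map_measureReal_apply_of_aemeasurable hmeas
    (measurableSet_le (by fun_prop) (by fun_prop))]
  refine ENNReal.toReal_mono (measure_ne_top _ _) (measure_mono_ae ?_)
  filter_upwards [ae_of_ae_map hmeas (hlaw ▸ ae_gaussianSeq_summable_norm_mul_pow)] with ω hω hmem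
  change y ≤ _ * ‖chaosCoeff _ (fun k => N k ω) n‖
  rwa [← hmcCoeff_one_eq_chaosCoeff hω hlt]
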